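/- **Setting.** Let $M=(V,E,F)$ be a locally finite triangulation of a simply connected oriented surface without boundary, with dual vertices $V^*\cong F$ and dual faces $\cong V$. For an oriented edge $ij$ let $\{ijk\}$ and $\{jil\}$ be the triangles on its left and right. The cross ratio of $z:V\to\mathbb C$ at $ij$ is $$X_{ij}=-\frac{(z_k-z_i)(z_l-z_j)}{(z_i-z_l)(z_j-z_k)} .$$ $z$ is a *Delaunay circle pattern* if $z_i\neq z_j$ on every edge, $\sum_j \operatorname{Arg}X_{ij}=2\pi$ at every vertex $i$, and $0\le \operatorname{Arg}X_{ij}<\pi$ on every edge. Two patterns $z,\tilde z$ with cross ratios $X,\tilde X$ have the same shear coordinates if $\operatorname{Re}\log X=\operatorname{Re}\log\tilde X$. The *osculating Möbius transformation* from $z$ to $\tilde z$ is the map $A:V^*\to SL(2,\mathbb C)$ (determined up to sign on each face) such that $A_{ijk}$ maps $z_i,z_j,z_k$ to $\tilde z_i,\tilde z_j,\tilde z_k$. Hyperbolic space $\mathbb H^3$ is the set of Hermitian $2\times2$ matrices with determinant $1$ and positive trace, $\langle U,W\rangle=-\frac12\operatorname{tr}(U\,\mathrm{adj}\,W)$. A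 *horospherical net with hyperbolic Gauss map* $\tilde z:V\to\mathbb C$ is a map $f:V^*\to\mathbb H^3$ such that the vertices of the dual face $i$ lie on a horosphere tangent to $\partial\mathbb H^3$ at $\tilde z_i$, $\tilde z$ is a Delaunay circle pattern, and neighbouring horospheres are not tangent to each other. Each dual edge is realized as a shorter circular arc in the intersection of its two neighbouring horospheres; $\ell$ is its hyperbolic length and $\alpha\in(-\pi,\pi)$ the signed dihedral angle: if the dual edge crosses $ij$ from left to right, $T$ is its unit tangent vector and $N_i,N_j$ are the unit normals of the two horospheres pointing to their tangency points, then $\cos\alpha=\langle N_i,N_j\rangle$ and $\sin\alpha=\langle N_i\times N_j,T\rangle$. The integrated mean curvature of a dual face $\phi$ is $$H_\phi=\operatorname{area}(f(\phi))+\tfrac12\sum_{ij\in\phi}\ell_{ij}\tan\tfrac{\alpha_{ij}}2,$$ where the area, enclosed by the arcs on the horosphere, is counted with sign and multiplicity. The net is a *discrete CMC-1 surface* if $H_\phi=\operatorname{area}(f(\phi))$ for every dual face and $0\le\ell\tan\frac\alpha2+\operatorname{Arg}\tilde X<\pi$ on every edge. **Theorem 4.3.** Let $z,\tilde z:V\to\mathbb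 C$ be Delaunay circle patterns with the same shear coordinates, such that $z_i\bar z_j\neq-1$ for all adjacent $i,j$. Then the osculating Möbius transformation $A:V^*\to SL(2,\mathbb C)$ from $z$ to $\tilde z$ exists, and for every choice of its signs $f:=AA^*$ is a discrete CMC-1 surface with hyperbolic Gauss map $\tilde z$. Conversely, let $f:V^*\to\mathbb H^3$ be a discrete CMC-1 surface with hyperbolic Gauss map $\tilde z:V\to\mathbb C$. Then there is a Delaunay circle pattern $z:V\to\mathbb C$ with the same shear coordinates as $\tilde z$, and with $z_i\bar z_j\neq-1$ for all adjacent $i,j$, such that $f=AA^*$, where $A$ is the osculating Möbius transformation from $z$ to $\tilde z$. -/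

import Mathlib

open scoped Matrix ComplexConjugate

noncomputable section

/-! ### Triangulated surfaces and their dual cell decompositions -/

/-- A locally finite triangulation of an oriented surface without boundary, given by its oriented
edges (darts). A dart `d` runs from the vertex `src d` to the vertex `src (rev d)`, it has the
triangle `face d` on its left and `face (rev d)` on its right, and `next d` is the dart following
`d` on the boundary of `face d`. The faces are also the vertices of the dual cell decomposition. -/
structure SurfaceTriangulation (V F D : Type*) where
  rev : D → D
  next : D → D
  src : D → V
  face : D → F
  rev_rev : ∀ d, rev (rev d) = d
  rev_ne : ∀ d, rev d ≠ d
  next_next_next : ∀ d, next (next (next d)) = d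
  next_ne : ∀ d, next d ≠ d
  src_surjective : Function.Surjective src
  face_surjective : Function.Surjective face
  /-- The boundary of a face consists of three darts. -/
  face_eq_iff : ∀ d e, face d = face e ↔ e = d ∨ e = next d ∨ e = next (next d)
  /-- The darts issuing from a vertex form one cycle, in which `next (rev d)` follows `d` in the
  clockwise order: the link of every vertex is a circle. -/
  src_eq_iff : ∀ d e, src d = src e ↔ ∃ n : ℕ, (fun x => next (rev x))^[n] d = e
  star_finite : ∀ v, {d | src d = v}.Finite

namespace SurfaceTriangulation

variable {V F D : Type*} (M : SurfaceTriangulation V F D)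

/-- Terminal vertex of a dart. -/
def tgt (d : D) : V := M.src (M.rev d)

/-- The third vertex of the triangle on the left of a dart. -/
def apex (d : D) : V := M.src (M.next (M.next d))

/-- The clockwise next dart with the same source. -/
def rot (d : D) : D := M.next (M.rev d)

/-- The darts issuing from a vertex; they are also the edges of the corresponding dual face. -/
def star (v : V) : Finset D := (M.star_finite v).toFinset

/-- A path in the dual graph from one dual vertex to another, as the list of the darts that it
crosses, each from its left to its right. -/
def IsDualPath : F → List D → F → Prop
  | φ, [], ψ => φ = ψ
  | φ, d :: p, ψ => M.face d = φ ∧ IsDualPath (M.face (M.rev d)) p ψ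

/-- Elementary homotopies of edge paths in the dual cell decomposition: inserting an edge followed
by its reverse, or the boundary of a dual face (run through a number of times). -/
inductive DualMove : List D → List D → Prop
  | backtrack (p q : List D) (d : D) : DualMove (p ++ q) (p ++ [d, M.rev d] ++ q)
  | around (p q : List D) (d : D) (n : ℕ) (h : M.rot^[n] d = d) :
      DualMove (p ++ q) (p ++ (List.range n).map (fun k => M.rot^[k] d) ++ q)

/-- Homotopy of dual edge paths with fixed end points. -/
def DualHomotopic (φ ψ : F) : List D → List D → Prop :=
  Relation.EqvGen fun p q => M.IsDualPath φ p ψ ∧ M.IsDualPath φ q ψ ∧ M.DualMove p q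

/-- The surface is simply connected: it is connected and its edge path group, computed in the dual
cell decomposition, is trivial. -/
def IsSimplyConnected : Prop :=
  (∀ φ ψ, ∃ p, M.IsDualPath φ p ψ) ∧ ∀ φ p, M.IsDualPath φ p φ → M.DualHomotopic φ φ p []

/-! ### Circle patterns -/

/-- The cross ratio of a realization `z` at the edge `ij`, where `ijk` and `jil` are the triangles
on the left and on the right of `ij`. -/
def crossRatio (z : V → ℂ) (d : D) : ℂ :=
  -((z (M.apex d) - z (M.src d)) * (z (M.apex (M.rev d)) - z (M.tgt d))) /
    ((z (M.src d) - z (M.apex (M.rev d))) * (z (M.tgt d) - z (M.apex d)))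

/-- `z` is a Delaunay circle pattern: its triangles are non-degenerate, there is no branching at
the vertices, and the arguments of the cross ratios lie in `[0, π)`. -/
structure IsDelaunayPattern (z : V → ℂ) : Prop where
  edge_ne : ∀ d, z (M.src d) ≠ z (M.tgt d)
  no_branching : ∀ v, ∑ d ∈ M.star v, (M.crossRatio z d).arg = 2 * Real.pi
  arg_nonneg : ∀ d, 0 ≤ (M.crossRatio z d).arg
  arg_lt_pi : ∀ d, (M.crossRatio z d).arg < Real.pi

/-- Two realizations share the same shear coordinates. -/
def SameShear (z z' : V → ℂ) : Prop :=
  ∀ d, (Complex.log (M.crossRatio z d)).re = (Complex.log (M.crossRatio z' d)).re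

/-- `A` is (a lift to `SL(2, ℂ)` of) the osculating Möbius transformation from `z` to `z'`: on every
face, the Möbius transformation maps the three vertices of `z` to those of `z'`. -/
def IsOsculating (z z' : V → ℂ) (A : F → Matrix.SpecialLinearGroup (Fin 2) ℂ) : Prop :=
  ∀ d, ∃ c : ℂ, c ≠ 0 ∧
    (A (M.face d) : Matrix (Fin 2) (Fin 2) ℂ) *ᵥ ![z (M.src d), 1] = c • ![z' (M.src d), 1]

end SurfaceTriangulation

/-! ### Hyperbolic space in the Hermitian matrix model -/

/-- Two by two complex matrices; Minkowski space consists of the Hermitian ones. -/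
abbrev Mat2 := Matrix (Fin 2) (Fin 2) ℂ

/-- The Minkowski inner product of Hermitian matrices. -/
def mink (U W : Mat2) : ℝ := (-(1 / 2 : ℂ) * (U * W.adjugate).trace).re

/-- The coordinates `(x₀, x₁, x₂, x₃)` of the Hermitian matrix with rows `(x₀ + x₃, x₁ + i x₂)` and
`(x₁ - i x₂, x₀ - x₃)`. -/
def minkCoord (U : Mat2) : Fin 4 → ℝ :=
  ![(U 0 0 + U 1 1).re / 2, (U 0 1).re, (U 0 1).im, (U 0 0 - U 1 1).re / 2]

/-- The oriented volume form of Minkowski space. For a point `x` of hyperbolic space and tangent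
vectors `a`, `b`, `c` at `x`, `minkVol x a b c` is the triple product `⟨a × b, c⟩`. -/
def minkVol (a b c d : Mat2) : ℝ :=
  (Matrix.of ![minkCoord a, minkCoord b, minkCoord c, minkCoord d]).det

/-- Hyperbolic 3-space. -/
def hyperbolicSpace : Set Mat2 := {x | x.IsHermitian ∧ x.det = 1 ∧ 0 < x.trace.re}

/-- For `r > 0`, the vectors of the upper light cone representing the boundary point `w ∈ ℂ`; they
parametrize the horospheres touching the boundary at `w`. -/
def horoVec (w : ℂ) (r : ℝ) : Mat2 :=
  ((2 * r / (1 + ‖w‖ ^ 2) : ℝ) : ℂ) • !![((‖w‖ ^ 2 : ℝ) : ℂ), w; conj w, 1]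

/-- The horosphere of a vector `U` of the upper light cone. -/
def horosphere (U : Mat2) : Set Mat2 := {x | x ∈ hyperbolicSpace ∧ mink x U = -1}

/-- The unit normal at a point `x` of the horosphere of `U`, pointing to its point of tangency with
the boundary (the geodesic `cosh t • x + sinh t • (U - x)` tends to the direction of `U`). -/
def horoNormal (U x : Mat2) : Mat2 := U - x

/-- The center (in Minkowski space) of the circle in which the horospheres of `U` and `W` meet. -/
def circCenter (U W : Mat2) : Mat2 := (((-(mink U W))⁻¹ : ℝ) : ℂ) • (U + W)

/-- The radius of the circle through `x` in which the horospheres of `U` and `W` meet. -/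
def circRadius (U W x : Mat2) : ℝ :=
  Real.sqrt (mink (x - circCenter U W) (x - circCenter U W))

/-- The circle in which the horospheres of `U` and `W` meet, starting at `x` in the direction of the
unit tangent vector `T`, parametrized by the angle. -/
def circPoint (U W x T : Mat2) (t : ℝ) : Mat2 :=
  circCenter U W + (Real.cos t : ℂ) • (x - circCenter U W)
    + ((Real.sin t * circRadius U W x : ℝ) : ℂ) • T

/-- The derivative of `circPoint` in `t`; its Minkowski norm is `circRadius U W x`. -/
def circVelocity (U W x T : Mat2) (t : ℝ) : Mat2 :=
  ((-Real.sin t : ℝ) : ℂ) • (x - circCenter U W)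
    + ((Real.cos t * circRadius U W x : ℝ) : ℂ) • T

/-- The shorter circular arc from `x` to `y` in the intersection of the horospheres of `U` and `W`
leaves `x` in the direction of the unit tangent vector `T` and subtends the angle `τ`. -/
structure IsShortArc (U W x y T : Mat2) (τ : ℝ) : Prop where
  hermitian : T.IsHermitian
  unit : mink T T = 1
  tangent : mink T x = 0
  tangent_left : mink T U = 0
  tangent_right : mink T W = 0
  nonneg : 0 ≤ τ
  le_pi : τ ≤ Real.pi
  endpoint : circPoint U W x T τ = y

/-! ### Horospherical nets and discrete CMC-1 surfaces -/

/-- A horospherical net: a realization `f` of the dual vertices in hyperbolic space such that the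
vertices of each dual face lie on a horosphere, the tangency points `gauss` of the horospheres form
a Delaunay circle pattern, and the dual edges are realized as shorter circular arcs in the
intersections of neighboring horospheres; together with the dihedral angles `α` of neighboring
horospheres. The dual edge of the dart `d` is oriented from the face on the left of `d` to the face
on its right. -/
structure HorosphericalNet {V F D : Type*} (M : SurfaceTriangulation V F D) where
  f : F → Mat2
  gauss : V → ℂ
  size : V → ℝ
  T : D → Mat2
  τ : D → ℝ
  α : D → ℝ
  size_pos : ∀ v, 0 < size v
  mem_horosphere : ∀ d, f (M.face d) ∈ horosphere (horoVec (gauss (M.src d)) (size (M.src d)))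
  delaunay : M.IsDelaunayPattern gauss
  arc : ∀ d, IsShortArc (horoVec (gauss (M.src d)) (size (M.src d)))
    (horoVec (gauss (M.tgt d)) (size (M.tgt d))) (f (M.face d)) (f (M.face (M.rev d))) (T d) (τ d)
  α_mem : ∀ d, α d ∈ Set.Ioo (-Real.pi) Real.pi
  α_rev : ∀ d, α (M.rev d) = α d
  cos_α : ∀ d, Real.cos (α d) =
    mink (horoNormal (horoVec (gauss (M.src d)) (size (M.src d))) (f (M.face d)))
      (horoNormal (horoVec (gauss (M.tgt d)) (size (M.tgt d))) (f (M.face d)))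
  /-- The sign of the dihedral angle. The sides of a dual edge are named so that the face of `src d`
  is its left face and the face of `tgt d` its right face. -/
  sin_α : ∀ d, Real.sin (α d) = minkVol (f (M.face d))
      (horoNormal (horoVec (gauss (M.src d)) (size (M.src d))) (f (M.face d)))
      (horoNormal (horoVec (gauss (M.tgt d)) (size (M.tgt d))) (f (M.face d))) (T d)

namespace HorosphericalNet

variable {V F D : Type*} {M : SurfaceTriangulation V F D} (n : HorosphericalNet M)

/-- The light cone vector of the horosphere carrying a dual face. -/
def horo (v : V) : Mat2 := horoVec (n.gauss v) (n.size v)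

/-- The hyperbolic length of a dual edge (angle times speed). -/
def length (d : D) : ℝ :=
  n.τ d * circRadius (n.horo (M.src d)) (n.horo (M.tgt d)) (n.f (M.face d))

/-- The area that the circular arcs around a dual face enclose on its horosphere `H`. The induced
metric of `H` is flat. With `b` a point of `H`, the points of `H` being `b + v + ½⟨v, v⟩ U` with
`v` in the tangent plane of `H` at `b`, the integrand is the area form `½ v ∧ dv` of that plane;
so the sum is the area of the face by Green's formula, whatever `b`. It is counted with
multiplicity and with sign. In the convention of the dihedral angles the boundary of a face runs
clockwise about the normal `horoNormal`, hence the sign in front. -/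
def area (v : V) : ℝ :=
  -(1 / 2) * ∑ d ∈ M.star v, ∫ t in (0 : ℝ)..(n.τ d),
    minkVol (n.f (M.face (Function.surjInv M.src_surjective v))) (n.horo v)
      (circPoint (n.horo (M.src d)) (n.horo (M.tgt d)) (n.f (M.face d)) (n.T d) t)
      (circVelocity (n.horo (M.src d)) (n.horo (M.tgt d)) (n.f (M.face d)) (n.T d) t)

/-- The integrated mean curvature of a dual face. -/
def integratedMeanCurvature (v : V) : ℝ :=
  n.area v + (1 / 2) * ∑ d ∈ M.star v, n.length d * Real.tan (n.α d / 2)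

/-- A horospherical net is a discrete CMC-1 surface if on every face the integrated mean curvature
and the area have ratio one (written without a quotient, as the area of a face may vanish) and
`0 ≤ ℓ tan (α / 2) + Arg X̃ < π` on every edge. -/
structure IsCMC1 : Prop where
  mean_curvature : ∀ v, n.integratedMeanCurvature v = n.area v
  edge_nonneg : ∀ d, 0 ≤ n.length d * Real.tan (n.α d / 2) + (M.crossRatio n.gauss d).arg
  edge_lt_pi : ∀ d, n.length d * Real.tan (n.α d / 2) + (M.crossRatio n.gauss d).arg < Real.pi

end HorosphericalNet

/-- The realization `f` of the dual graph is a discrete CMC-1 surface with hyperbolic Gauss map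
`g`. -/
def IsDiscreteCMC1 {V F D : Type*} (M : SurfaceTriangulation V F D) (f : F → Mat2) (g : V → ℂ) :
    Prop :=
  ∃ n : HorosphericalNet M, n.f = f ∧ n.gauss = g ∧ n.IsCMC1

end

/-! Write the osculating map on lifts: for a dart `d`, the matrix of `face d` sends `(z_i, 1)` to `c
d • (z'_i, 1)`. Since the determinant is one, differences obey `z_i - z_j = c d * c (next d) * (z'_i
- z'_j)`, so the two cross ratios differ by the factor `c d * c (rev d) / (c (rot d) * c (next d))`
(`crossRatio_of_osculating`). Equal shear coordinates make this factor unimodular; combined with the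
consistency of the two triangles at an edge, `‖c‖` then depends only on the source vertex. As `A *
Aᴴ` pairs with the light vector at `z'_i` through `‖c‖` and `z_i` alone (`normSq_mul_mink_horoVec`),
the points of a dual face share a horosphere.

Across an edge the transition matrix fixes both tangency points, with unimodular eigenvalues: it is
a rotation about the geodesic between them, by `δ = Arg X - Arg X'`. The intersection circle of two
horospheres with dihedral angle `α` has radius `ρ` with `ρ * |tan (α / 2)| = 1`, so `ℓ * tan (α /
2)` is the signed angle of the arc, namely `δ` (`IsShortArc.rotation`, `exists_isShortArc`). The
mean curvature condition therefore says that the angles `δ` around a vertex add up to zero, which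
holds because both patterns have angle sum `2π`. The condition `z_i * conj z_j ≠ -1` says that
neighbouring horospheres are not tangent.

Conversely, the angles `ℓ * tan (α / 2)` define rotations in `SL(2, ℂ)`. Their product around a
vertex has eigenvalue one and fixes a point of hyperbolic space, hence is the identity
(`eq_one_of_hermCong_eq`). Simple connectivity integrates them to `A` with `f = A * Aᴴ`, and `z` is
the preimage of the Gauss map under `A`. A unitary factor on the right of `A` leaves `f` unchanged
and keeps the countably many vertices of `z` away from infinity. -/

/-! ### The congruence action on Hermitian matrices and its invariants -/

/-- The matrix `P K Pᴴ`. -/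
def hermCong (P K : Mat2) : Mat2 := P * K * Pᴴ

/-- The Hermitian matrix with the given diagonal and upper right entry. -/
def hermMat (a b : ℝ) (β : ℂ) : Mat2 := !![(a : ℂ), β; conj β, (b : ℂ)]

theorem isHermitian_hermMat (a b : ℝ) (β : ℂ) : (hermMat a b β).IsHermitian := by
  ext i j
  fin_cases i <;> fin_cases j <;> simp [hermMat]

theorem exists_eq_hermMat {K : Mat2} (hK : K.IsHermitian) : ∃ a b β, K = hermMat a b β := by
  refine ⟨(K 0 0).re, (K 1 1).re, K 0 1, ?_⟩
  have h00 := hK.apply 0 0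
  have h11 := hK.apply 1 1
  have h01 := hK.apply 1 0
  ext i j
  fin_cases i <;> fin_cases j
  · exact (Complex.conj_eq_iff_re.1 h00).symm
  · rfl
  · exact h01.symm
  · exact (Complex.conj_eq_iff_re.1 h11).symm

theorem isHermitian_hermCong (P : Mat2) {K : Mat2} (hK : K.IsHermitian) :
    (hermCong P K).IsHermitian :=
  Matrix.isHermitian_mul_mul_conjTranspose P hK

theorem hermCong_add (P K L : Mat2) : hermCong P (K + L) = hermCong P K + hermCong P L := by
  simp [hermCong, mul_add, add_mul]

theorem hermCong_sub (P K L : Mat2) : hermCong P (K - L) = hermCong P K - hermCong P L := by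
  simp [hermCong, mul_sub, sub_mul]

theorem hermCong_smul (P K : Mat2) (c : ℂ) : hermCong P (c • K) = c • hermCong P K := by
  simp [hermCong]

theorem hermCong_hermCong (P Q K : Mat2) : hermCong P (hermCong Q K) = hermCong (P * Q) K := by
  simp [hermCong, Matrix.conjTranspose_mul, mul_assoc]

theorem hermCong_one_right (P : Mat2) : hermCong P 1 = P * Pᴴ := by simp [hermCong]

theorem hermCong_inv_cancel {P : Mat2} (hP : P.det ≠ 0) (x : Mat2) :
    hermCong P (hermCong P⁻¹ x) = x := by
  rw [hermCong_hermCong, Matrix.mul_nonsing_inv _ (isUnit_iff_ne_zero.2 hP)]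
  simp [hermCong]

theorem exists_eq_hermCong {P : Mat2} (hP : P.det ≠ 0) {x : Mat2} (hx : x.IsHermitian) :
    ∃ a b β, x = hermCong P (hermMat a b β) := by
  obtain ⟨a, b, β, h⟩ := exists_eq_hermMat (isHermitian_hermCong P⁻¹ hx)
  exact ⟨a, b, β, by rw [← h, hermCong_inv_cancel hP]⟩

theorem det_hermCong (P K : Mat2) : (hermCong P K).det = (Complex.normSq P.det : ℂ) * K.det := by
  rw [hermCong, Matrix.det_mul, Matrix.det_mul, Matrix.det_conjTranspose, ← Complex.mul_conj]
  simp only [RCLike.star_def]; ring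

theorem hermCong_mul_adjugate (P K L : Mat2) :
    hermCong P K * (hermCong P L).adjugate = conj P.det • (P * (K * L.adjugate) * P.adjugate) := by
  have h : Pᴴ * Pᴴ.adjugate = conj P.det • (1 : Mat2) := by
    rw [Matrix.mul_adjugate, Matrix.det_conjTranspose]; rfl
  calc hermCong P K * (hermCong P L).adjugate
      = P * K * (Pᴴ * Pᴴ.adjugate) * (L.adjugate * P.adjugate) := by
        simp only [hermCong, Matrix.adjugate_mul_distrib, mul_assoc]
    _ = _ := by rw [h]; simp [mul_assoc]

theorem mink_hermCong (P K L : Mat2) :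
    mink (hermCong P K) (hermCong P L) = Complex.normSq P.det * mink K L := by
  have h : (hermCong P K * (hermCong P L).adjugate).trace
      = (Complex.normSq P.det : ℂ) * (K * L.adjugate).trace := by
    rw [hermCong_mul_adjugate, Matrix.trace_smul, Matrix.trace_mul_comm, ← mul_assoc,
      Matrix.adjugate_mul, ← Complex.mul_conj]
    simp; ring
  rw [mink, mink, h, mul_left_comm, Complex.re_ofReal_mul]

theorem mink_hermMat (a b a' b' : ℝ) (β γ : ℂ) : mink (hermMat a b β) (hermMat a' b' γ) =
    -(a * b' + b * a') / 2 + (β * conj γ).re := by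
  simp [mink, hermMat, Matrix.adjugate_fin_two, Matrix.trace_fin_two]
  ring

theorem minkVol_hermMat (a b a₁ b₁ a₂ b₂ a₃ b₃ : ℝ) (β β₁ β₂ β₃ : ℂ) :
    minkVol (hermMat a b β) (hermMat a₁ b₁ β₁) (hermMat a₂ b₂ β₂) (hermMat a₃ b₃ β₃) =
    -(1 / 2) * ((hermMat a b β * (hermMat a₁ b₁ β₁).adjugate) *
      (hermMat a₂ b₂ β₂ * (hermMat a₃ b₃ β₃).adjugate)).trace.im := by
  simp [minkVol, minkCoord, hermMat, Matrix.adjugate_fin_two, Matrix.trace_fin_two,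
    Matrix.det_succ_row_zero, Fin.sum_univ_succ,
    Fin.succAbove]
  ring

/-- Unlike the coordinate determinant, the trace form shows how the volume behaves under congruence:
by `hermCong_mul_adjugate` each product `a * b.adjugate` is merely conjugated, up to a factor. -/
theorem minkVol_eq_trace {a b c d : Mat2} (ha : a.IsHermitian) (hb : b.IsHermitian)
    (hc : c.IsHermitian) (hd : d.IsHermitian) :
    minkVol a b c d = -(1 / 2) * ((a * b.adjugate) * (c * d.adjugate)).trace.im := by
  obtain ⟨_, _, _, rfl⟩ := exists_eq_hermMat ha
  obtain ⟨_, _, _, rfl⟩ := exists_eq_hermMat hb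
  obtain ⟨_, _, _, rfl⟩ := exists_eq_hermMat hc
  obtain ⟨_, _, _, rfl⟩ := exists_eq_hermMat hd
  exact minkVol_hermMat ..

theorem minkVol_hermCong (P : Mat2) {a b c d : Mat2} (ha : a.IsHermitian) (hb : b.IsHermitian)
    (hc : c.IsHermitian) (hd : d.IsHermitian) :
    minkVol (hermCong P a) (hermCong P b) (hermCong P c) (hermCong P d) =
      Complex.normSq P.det ^ 2 * minkVol a b c d := by
  rw [minkVol_eq_trace ha hb hc hd, minkVol_eq_trace (isHermitian_hermCong P ha)
    (isHermitian_hermCong P hb) (isHermitian_hermCong P hc) (isHermitian_hermCong P hd)]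
  have h : (hermCong P a * (hermCong P b).adjugate *
      (hermCong P c * (hermCong P d).adjugate)).trace =
      ((Complex.normSq P.det ^ 2 : ℝ) : ℂ) * (a * b.adjugate * (c * d.adjugate)).trace := by
    rw [hermCong_mul_adjugate, hermCong_mul_adjugate]
    have : P * (a * b.adjugate) * P.adjugate * (P * (c * d.adjugate) * P.adjugate) =
        P.det • (P * (a * b.adjugate * (c * d.adjugate)) * P.adjugate) := by
      calc _ = P * (a * b.adjugate) * (P.adjugate * P) * ((c * d.adjugate) * P.adjugate) := by
            simp only [mul_assoc]
        _ = _ := by rw [Matrix.adjugate_mul]; simp [mul_assoc]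
    rw [smul_mul_smul_comm, this, Matrix.trace_smul, Matrix.trace_smul, Matrix.trace_mul_comm,
      ← mul_assoc, Matrix.adjugate_mul]
    push_cast
    rw [← Complex.mul_conj]
    simp; ring
  rw [h, Complex.im_ofReal_mul]
  ring

theorem mink_comm {U W : Mat2} (hU : U.IsHermitian) (hW : W.IsHermitian) :
    mink U W = mink W U := by
  obtain ⟨_, _, _, rfl⟩ := exists_eq_hermMat hU
  obtain ⟨_, _, _, rfl⟩ := exists_eq_hermMat hW
  rw [mink_hermMat, mink_hermMat]
  simp
  ring

theorem hermMat_sub (a b a' b' : ℝ) (β γ : ℂ) :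
    hermMat a b β - hermMat a' b' γ = hermMat (a - a') (b - b') (β - γ) := by
  ext i j; fin_cases i <;> fin_cases j <;> simp [hermMat]

theorem hermMat_add (a b a' b' : ℝ) (β γ : ℂ) :
    hermMat a b β + hermMat a' b' γ = hermMat (a + a') (b + b') (β + γ) := by
  ext i j; fin_cases i <;> fin_cases j <;> simp [hermMat]

theorem ofReal_smul_hermMat (c a b : ℝ) (β : ℂ) :
    (c : ℂ) • hermMat a b β = hermMat (c * a) (c * b) (c * β) := by
  ext i j; fin_cases i <;> fin_cases j <;> simp [hermMat]

theorem det_hermMat (a b : ℝ) (β : ℂ) :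
    (hermMat a b β).det = ((a * b - Complex.normSq β : ℝ) : ℂ) := by
  simp [hermMat, Matrix.det_fin_two, Complex.mul_conj]

theorem hermMat_inj {a b a' b' : ℝ} {β γ : ℂ} (h : hermMat a b β = hermMat a' b' γ) :
    a = a' ∧ b = b' ∧ β = γ := by
  have h0 := congr_fun₂ h 0 0
  have h1 := congr_fun₂ h 1 1
  have h2 := congr_fun₂ h 0 1
  simp [hermMat] at h0 h1 h2
  exact ⟨h0, h1, h2⟩

theorem hermCong_injective {P : Mat2} (hP : P.det ≠ 0) : Function.Injective (hermCong P) := by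
  intro K L h
  have h' := congr_arg (hermCong P⁻¹) h
  rw [hermCong_hermCong, hermCong_hermCong, Matrix.nonsing_inv_mul _ (isUnit_iff_ne_zero.2 hP)]
    at h'
  simpa [hermCong] using h'

theorem tan_half_eq (α : ℝ) : Real.tan (α / 2) = Real.sin α / (1 + Real.cos α) := by
  have h1 : Real.sin α = 2 * Real.sin (α / 2) * Real.cos (α / 2) := by
    rw [← Real.sin_two_mul]; congr 1; ring
  have h2 : 1 + Real.cos α = 2 * Real.cos (α / 2) * Real.cos (α / 2) := by
    have := Real.cos_two_mul (α / 2)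
    rw [show 2 * (α / 2) = α by ring] at this
    rw [this]; ring
  rw [h1, h2, Real.tan_eq_sin_div_cos]
  -- Where the cosine vanishes both sides are `0`, by the convention for division by zero.
  by_cases h : Real.cos (α / 2) = 0
  · simp [h]
  · rw [mul_div_mul_right _ _ h, mul_div_mul_left _ _ two_ne_zero]

/-! ### Two light vectors spanning a frame -/

theorem mink_frame (P : Mat2) : mink (hermCong P (hermMat 1 0 0)) (hermCong P (hermMat 0 1 0)) =
    -(Complex.normSq P.det / 2) := by
  rw [mink_hermCong, mink_hermMat]; simp; ring

theorem circCenter_frame (P : Mat2) :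
    circCenter (hermCong P (hermMat 1 0 0)) (hermCong P (hermMat 0 1 0)) =
      hermCong P (hermMat (2 / Complex.normSq P.det) (2 / Complex.normSq P.det) 0) := by
  rw [circCenter, mink_frame, ← hermCong_add, hermMat_add, ← hermCong_smul, ofReal_smul_hermMat]
  simp

theorem mink_normal_frame {U W x : Mat2} (hU : U.IsHermitian) (hx : x ∈ hyperbolicSpace)
    (hxx : mink x x = -1) (hxU : mink x U = -1) (hxW : mink x W = -1) :
    mink (U - x) (W - x) = 1 + mink U W := by
  have h : mink (U - x) (W - x) = mink U W - mink U x - mink x W + mink x x := by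
    simp [mink, sub_mul, mul_sub, Matrix.adjugate_fin_two, Matrix.trace_fin_two, Matrix.mul_apply]
    ring
  rw [h, mink_comm hU hx.1, hxx, hxU, hxW]; ring

theorem mink_self_hermMat (a b : ℝ) (β : ℂ) :
    mink (hermMat a b β) (hermMat a b β) = Complex.normSq β - a * b := by
  rw [mink_hermMat, Complex.mul_conj]; simp; ring

/-- Points of the intersection of two horospheres in the frame of their light vectors. -/
theorem exists_frame_of_mem {P x : Mat2} (hP : P.det ≠ 0)
    (hU : x ∈ horosphere (hermCong P (hermMat 1 0 0)))
    (hW : x ∈ horosphere (hermCong P (hermMat 0 1 0))) :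
    ∃ β, x = hermCong P (hermMat (2 / Complex.normSq P.det) (2 / Complex.normSq P.det) β) ∧
      Complex.normSq β = 4 / Complex.normSq P.det ^ 2 - 1 / Complex.normSq P.det := by
  obtain ⟨a, b, β, rfl⟩ := exists_eq_hermCong hP hU.1.1
  have hm : Complex.normSq P.det ≠ 0 := by simpa using hP
  have hU' := hU.2
  have hW' := hW.2
  have hd := hU.1.2.1
  rw [mink_hermCong, mink_hermMat] at hU' hW'
  rw [det_hermCong, det_hermMat] at hd
  norm_cast at hd
  simp at hU' hW'
  have ha : a = 2 / Complex.normSq P.det := by field_simp; linarith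
  have hb : b = 2 / Complex.normSq P.det := by field_simp; linarith
  refine ⟨β, by rw [hb, ha], ?_⟩
  have : Complex.normSq β = a * b - 1 / Complex.normSq P.det := by field_simp; linarith
  rw [this, ha, hb]; field_simp; norm_num

theorem circRadius_frame {P : Mat2} (β : ℂ) :
    circRadius (hermCong P (hermMat 1 0 0)) (hermCong P (hermMat 0 1 0))
      (hermCong P (hermMat (2 / Complex.normSq P.det) (2 / Complex.normSq P.det) β)) =
      Real.sqrt (Complex.normSq P.det * Complex.normSq β) := by
  rw [circRadius, circCenter_frame, ← hermCong_sub, hermMat_sub, mink_hermCong, mink_self_hermMat]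
  simp

theorem circPoint_frame {P : Mat2} (β γ : ℂ) (t : ℝ) :
    circPoint (hermCong P (hermMat 1 0 0)) (hermCong P (hermMat 0 1 0))
      (hermCong P (hermMat (2 / Complex.normSq P.det) (2 / Complex.normSq P.det) β))
      (hermCong P (hermMat 0 0 γ)) t =
      hermCong P (hermMat (2 / Complex.normSq P.det) (2 / Complex.normSq P.det)
        (Real.cos t * β +
          (Real.sin t * Real.sqrt (Complex.normSq P.det * Complex.normSq β) : ℝ) * γ)) := by
  rw [circPoint, circRadius_frame, circCenter_frame, ← hermCong_sub, hermMat_sub,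
    ← hermCong_smul, ← hermCong_smul, ofReal_smul_hermMat, ofReal_smul_hermMat, ← hermCong_add,
    ← hermCong_add, hermMat_add, hermMat_add]
  simp

theorem minkVol_frame (P : Mat2) (a : ℝ) (β γ : ℂ) :
    minkVol (hermCong P (hermMat a a β))
      (hermCong P (hermMat 1 0 0) - hermCong P (hermMat a a β))
      (hermCong P (hermMat 0 1 0) - hermCong P (hermMat a a β))
      (hermCong P (hermMat 0 0 γ)) =
      -(Complex.normSq P.det ^ 2 / 2) * (conj β * γ).im := by
  rw [← hermCong_sub, ← hermCong_sub, hermMat_sub, hermMat_sub, minkVol_hermCong]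
  · simp [minkVol, minkCoord, hermMat, Matrix.det_succ_row_zero, Fin.sum_univ_succ, Fin.succAbove]
    ring
  all_goals exact isHermitian_hermMat _ _ _

/-- The intersection of two horospheres with dihedral angle `α` is a circle; following it over the
angle `τ` amounts to a rotation by `τ ρ tan (α / 2)` about the geodesic between the tangency
points. -/
theorem IsShortArc.rotation {P x y T : Mat2} {τ α : ℝ} (hP : P.det ≠ 0)
    (hU : x ∈ horosphere (hermCong P (hermMat 1 0 0)))
    (hW : x ∈ horosphere (hermCong P (hermMat 0 1 0)))
    (hT : IsShortArc (hermCong P (hermMat 1 0 0)) (hermCong P (hermMat 0 1 0)) x y T τ)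
    (hα : α ∈ Set.Ioo (-Real.pi) Real.pi)
    (hcos : Real.cos α = mink (horoNormal (hermCong P (hermMat 1 0 0)) x)
      (horoNormal (hermCong P (hermMat 0 1 0)) x))
    (hsin : Real.sin α = minkVol x (horoNormal (hermCong P (hermMat 1 0 0)) x)
      (horoNormal (hermCong P (hermMat 0 1 0)) x) T) :
    Complex.normSq P.det < 4 ∧ ∃ β, β ≠ 0 ∧
      x = hermCong P (hermMat (2 / Complex.normSq P.det) (2 / Complex.normSq P.det) β) ∧
      y = hermCong P (hermMat (2 / Complex.normSq P.det) (2 / Complex.normSq P.det)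
        (Complex.exp (-(τ * circRadius (hermCong P (hermMat 1 0 0)) (hermCong P (hermMat 0 1 0)) x *
          Real.tan (α / 2) : ℝ) * Complex.I) * β)) := by
  have hm : 0 < Complex.normSq P.det := Complex.normSq_pos.2 hP
  obtain ⟨β, hx, hβ⟩ := exists_frame_of_mem hP hU hW
  obtain ⟨a, b, γ, rfl⟩ := exists_eq_hermCong hP hT.hermitian
  have hxx : mink x x = -1 := by
    rw [hx, mink_hermCong, mink_self_hermMat, hβ]; field_simp; ring
  have hcos' : Real.cos α = 1 - Complex.normSq P.det / 2 := by
    rw [hcos, horoNormal, horoNormal, mink_normal_frame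
      (isHermitian_hermCong _ (isHermitian_hermMat _ _ _)) hU.1 hxx hU.2 hW.2, mink_frame]
    ring
  -- The open interval for `α` excludes `cos α = -1`, that is, tangent horospheres (`normSq P.det =
  -- 4`).
  have hneg : -1 < Real.cos α := by
    rw [← Real.cos_abs, ← Real.cos_pi]
    exact Real.cos_lt_cos_of_nonneg_of_le_pi (abs_nonneg _) le_rfl (abs_lt.2 hα)
  have hm4 : Complex.normSq P.det < 4 := by linarith
  have hend := hT.endpoint
  have h1 := hT.unit
  have h2 := hT.tangent
  have h3 := hT.tangent_left
  have h4 := hT.tangent_right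
  subst hx
  generalize hmdef : Complex.normSq P.det = m at *
  have hβpos : 0 < Complex.normSq β := by
    rw [hβ, show 4 / m ^ 2 - 1 / m = (4 - m) / m ^ 2 by field_simp]
    exact div_pos (by linarith) (by positivity)
  rw [mink_hermCong, mink_hermMat, hmdef] at h3 h4
  have hb : b = 0 := by simpa [hm.ne'] using h3
  have ha : a = 0 := by simpa [hm.ne'] using h4
  subst ha hb
  rw [mink_hermCong, mink_self_hermMat, hmdef] at h1
  rw [mink_hermCong, mink_hermMat, hmdef] at h2
  -- The tangent vector is orthogonal to the radius, so `γ` is an imaginary multiple of `β`.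
  have hre : (conj β * γ).re = 0 := by
    have : (γ * conj β).re = 0 := by simpa [hm.ne'] using h2
    rwa [mul_comm]
  have hvol := minkVol_frame P (2 / m) β γ
  rw [horoNormal, horoNormal] at hsin
  rw [hvol, hmdef] at hsin
  set q := (conj β * γ).im with hq
  have hqI : conj β * γ = q * Complex.I := by
    apply Complex.ext
    · rw [hre, Complex.re_ofReal_mul, Complex.I_re, mul_zero]
    · rw [Complex.im_ofReal_mul, Complex.I_im, mul_one]
  have hγ : (Complex.normSq β : ℂ) * γ = q * Complex.I * β := by
    rw [← hqI, ← Complex.mul_conj]; ring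
  have hq2 : q ^ 2 = Complex.normSq β * Complex.normSq γ := by
    have := congr_arg Complex.normSq hqI
    simp at this
    rw [this]; ring
  have hrad := circRadius_frame (P := P) β
  have hpt := circPoint_frame (P := P) β γ τ
  rw [hmdef] at hrad hpt
  rw [hrad]
  set ρ := Real.sqrt (m * Complex.normSq β) with hρ
  have hρ2 : ρ ^ 2 = m * Complex.normSq β := Real.sq_sqrt (by positivity)
  have htan : Real.tan (α / 2) = -q / Complex.normSq β := by
    rw [tan_half_eq, hsin, hcos', hβ]
    have h5 : (4 : ℝ) - m ≠ 0 := by linarith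
    have h6 : 1 + (1 - m / 2) = (4 - m) / 2 := by ring
    have h7 : 4 / m ^ 2 - 1 / m = (4 - m) / m ^ 2 := by field_simp
    rw [h7, h6]
    field_simp
  set e := ρ * Real.tan (α / 2) with he
  -- The radius is the reciprocal of `|tan (α / 2)|`; the sign `e` records the sense in which the
  -- arc runs.
  have he2 : e ^ 2 = 1 := by
    rw [he, htan, mul_pow, hρ2, div_pow, neg_sq, hq2]
    field_simp
    linarith
  have hργ : (ρ : ℂ) * γ = -(e * Complex.I) * β := by
    have hne : (Complex.normSq β : ℂ) ≠ 0 := by exact_mod_cast hβpos.ne'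
    apply mul_left_cancel₀ hne
    rw [mul_left_comm, hγ, he, htan]
    push_cast
    field_simp
  refine ⟨hm4, β, Complex.normSq_pos.1 hβpos, rfl, ?_⟩
  rw [← hend, hpt]
  congr 2
  have hexp : Complex.exp (-(τ * ρ * Real.tan (α / 2) : ℝ) * Complex.I) =
      Real.cos τ - e * Real.sin τ * Complex.I := by
    rw [mul_assoc, ← he]
    rcases (sq_eq_sq_iff_eq_or_eq_neg.1 (he2.trans (one_pow 2).symm)) with h | h
    all_goals
      rw [h, Complex.exp_mul_I]
      push_cast
      simp [Complex.cos_neg, Complex.sin_neg, sub_eq_add_neg]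
  rw [hexp]
  push_cast
  rw [mul_assoc _ (ρ : ℂ), hργ]
  ring

/-- Every rotation by an angle in `(-π, π)` is realized by a short circular arc. -/
theorem exists_isShortArc {P : Mat2} {β : ℂ} {δ : ℝ} (hP : P.det ≠ 0)
    (hm4 : Complex.normSq P.det < 4)
    (hU : hermCong P (hermMat (2 / Complex.normSq P.det) (2 / Complex.normSq P.det) β) ∈
      horosphere (hermCong P (hermMat 1 0 0)))
    (hW : hermCong P (hermMat (2 / Complex.normSq P.det) (2 / Complex.normSq P.det) β) ∈
      horosphere (hermCong P (hermMat 0 1 0)))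
    (hδ : |δ| < Real.pi) {α : ℝ}
    (hα : α = (if 0 ≤ δ then 1 else -1) * Real.arccos (1 - Complex.normSq P.det / 2)) :
    ∃ T, IsShortArc (hermCong P (hermMat 1 0 0)) (hermCong P (hermMat 0 1 0))
      (hermCong P (hermMat (2 / Complex.normSq P.det) (2 / Complex.normSq P.det) β))
      (hermCong P (hermMat (2 / Complex.normSq P.det) (2 / Complex.normSq P.det)
        (Complex.exp (-δ * Complex.I) * β))) T |δ| ∧
      α ∈ Set.Ioo (-Real.pi) Real.pi ∧
      (Real.cos α = mink (horoNormal (hermCong P (hermMat 1 0 0))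
        (hermCong P (hermMat (2 / Complex.normSq P.det) (2 / Complex.normSq P.det) β)))
      (horoNormal (hermCong P (hermMat 0 1 0))
        (hermCong P (hermMat (2 / Complex.normSq P.det) (2 / Complex.normSq P.det) β)))) ∧
      (Real.sin α = minkVol
        (hermCong P (hermMat (2 / Complex.normSq P.det) (2 / Complex.normSq P.det) β))
        (horoNormal (hermCong P (hermMat 1 0 0))
        (hermCong P (hermMat (2 / Complex.normSq P.det) (2 / Complex.normSq P.det) β)))
        (horoNormal (hermCong P (hermMat 0 1 0))
        (hermCong P (hermMat (2 / Complex.normSq P.det) (2 / Complex.normSq P.det) β))) T) ∧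
      |δ| * circRadius (hermCong P (hermMat 1 0 0)) (hermCong P (hermMat 0 1 0))
        (hermCong P (hermMat (2 / Complex.normSq P.det) (2 / Complex.normSq P.det) β)) *
        Real.tan (α / 2) = δ := by
  have hm : 0 < Complex.normSq P.det := Complex.normSq_pos.2 hP
  have hβ : Complex.normSq β = 4 / Complex.normSq P.det ^ 2 - 1 / Complex.normSq P.det := by
    obtain ⟨β', h, h'⟩ := exists_frame_of_mem hP hU hW
    rwa [(hermMat_inj (hermCong_injective hP h)).2.2]
  have hxx : mink (hermCong P (hermMat (2 / Complex.normSq P.det) (2 / Complex.normSq P.det) β))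
      (hermCong P (hermMat (2 / Complex.normSq P.det) (2 / Complex.normSq P.det) β)) = -1 := by
    rw [mink_hermCong, mink_self_hermMat, hβ]; field_simp; ring
  have hcosN := mink_normal_frame
      (isHermitian_hermCong P (isHermitian_hermMat 1 0 0)) hU.1 hxx hU.2 hW.2
  rw [mink_frame] at hcosN
  set e : ℝ := if 0 ≤ δ then 1 else -1 with he
  have heδ : δ = e * |δ| := by
    rw [he]; split_ifs with h
    · rw [abs_of_nonneg h, one_mul]
    · rw [abs_of_neg (not_le.1 h)]; ring
  have he1 : e = 1 ∨ e = -1 := by rw [he]; split_ifs <;> simp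
  have hrad := circRadius_frame (P := P) β
  have hvol := fun γ => minkVol_frame P (2 / Complex.normSq P.det) β γ
  have hpt := fun γ => circPoint_frame (P := P) β γ |δ|
  generalize hmdef : Complex.normSq P.det = m at *
  have hβpos : 0 < Complex.normSq β := by
    rw [hβ, show 4 / m ^ 2 - 1 / m = (4 - m) / m ^ 2 by field_simp]
    exact div_pos (by linarith) (by positivity)
  set ρ := Real.sqrt (m * Complex.normSq β) with hρ
  have hρ2 : ρ ^ 2 = m * Complex.normSq β := Real.sq_sqrt (by positivity)
  have hρ2' : ρ ^ 2 = (4 - m) / m := by rw [hρ2, hβ]; field_simp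
  have hρpos : 0 < ρ := Real.sqrt_pos.2 (by positivity)
  have hρC : (ρ : ℂ) ≠ 0 := by exact_mod_cast hρpos.ne'
  have hcosα : Real.cos α = 1 - m / 2 := by
    have : Real.cos α = Real.cos (Real.arccos (1 - m / 2)) := by
      rcases he1 with h | h <;> simp [hα, h]
    rw [this, Real.cos_arccos (by linarith) (by linarith)]
  have hsinα : Real.sin α = e * (m * ρ / 2) := by
    have : Real.sin α = e * Real.sin (Real.arccos (1 - m / 2)) := by
      rcases he1 with h | h <;> simp [hα, h]
    rw [this, Real.sin_arccos]
    congr 1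
    rw [Real.sqrt_eq_iff_mul_self_eq_of_pos (by positivity), ← sq, div_pow, mul_pow, hρ2']
    field_simp
    ring
  have hlt : Real.arccos (1 - m / 2) < Real.pi := by
    rw [← Real.arccos_neg_one]
    exact Real.arccos_lt_arccos le_rfl (by linarith) (by linarith)
  have hnn := Real.arccos_nonneg (1 - m / 2)
  -- The radius vector `β` turned by a right angle in the sense given by `e` and normalized by `ρ`,
  -- so that the circle multiplies `β` by `exp (-δ i)` after the angle `|δ|`.
  refine ⟨hermCong P (hermMat 0 0 (-(e * Complex.I) * β / ρ)), ?_, ?_, ?_, ?_, ?_⟩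
  · constructor
    · exact isHermitian_hermCong _ (isHermitian_hermMat _ _ _)
    · rw [mink_hermCong, mink_self_hermMat, hmdef]
      have : e * e = 1 := by rcases he1 with h | h <;> simp [h]
      simp only [Complex.normSq_div, Complex.normSq_mul, Complex.normSq_neg,
        Complex.normSq_ofReal, Complex.normSq_I, this]
      rw [← sq ρ, hρ2]
      field_simp
      simp
    · rw [mink_hermCong, mink_hermMat]
      have : -(e * Complex.I) * β / ρ * conj β =
          ((-(e * Complex.normSq β / ρ) : ℝ) : ℂ) * Complex.I := by
        push_cast
        rw [← Complex.mul_conj]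
        ring
      rw [this]
      simp
    · rw [mink_hermCong, mink_hermMat]; simp
    · rw [mink_hermCong, mink_hermMat]; simp
    · exact abs_nonneg _
    · exact hδ.le
    · rw [hpt]
      congr 2
      have hexp : Complex.exp (-δ * Complex.I) =
          Real.cos |δ| - e * Real.sin |δ| * Complex.I := by
        rw [heδ]
        rcases he1 with h | h
        all_goals
          rw [h, Complex.exp_mul_I]
          push_cast
          simp [Complex.cos_neg, Complex.sin_neg, sub_eq_add_neg]
      rw [hexp]
      push_cast
      field_simp
      ring
  · rcases he1 with h | h <;> rw [hα, h] <;> constructor <;> linarith [Real.pi_pos]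
  · rw [horoNormal, horoNormal, hcosN, hcosα]; ring
  · rw [horoNormal, horoNormal, hvol, hsinα]
    have : conj β * (-(e * Complex.I) * β / ρ) =
          ((-(e * Complex.normSq β / ρ) : ℝ) : ℂ) * Complex.I := by
        push_cast
        rw [← Complex.mul_conj]
        ring
    rw [this]
    simp only [Complex.im_ofReal_mul, Complex.I_im, mul_one]
    have : Complex.normSq β = ρ ^ 2 / m := by rw [hρ2]; field_simp
    rw [this]
    field_simp
  · rw [hrad, tan_half_eq, hsinα, hcosα]
    have h5 : (4 : ℝ) - m ≠ 0 := by linarith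
    have h6 : 1 + (1 - m / 2) = m * ρ ^ 2 / 2 := by rw [hρ2']; field_simp; ring
    rw [h6, heδ, abs_mul, abs_abs]
    have : |e| = 1 := by rcases he1 with h | h <;> simp [h]
    rw [this]
    field_simp

namespace SurfaceTriangulation

variable {V F D : Type*} (M : SurfaceTriangulation V F D)

/-! ### Combinatorics of darts -/

theorem face_next (d : D) : M.face (M.next d) = M.face d :=
  ((M.face_eq_iff d (M.next d)).2 (Or.inr (Or.inl rfl))).symm

theorem src_rot (d : D) : M.src (M.rot d) = M.src d :=
  ((M.src_eq_iff d (M.rot d)).2 ⟨1, rfl⟩).symm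

theorem face_rot (d : D) : M.face (M.rot d) = M.face (M.rev d) := M.face_next _

theorem src_next (d : D) : M.src (M.next d) = M.tgt d := by
  have := M.src_rot (M.rev d)
  rwa [rot, M.rev_rev] at this

theorem tgt_rev (d : D) : M.tgt (M.rev d) = M.src d := by rw [tgt, M.rev_rev]

theorem tgt_next (d : D) : M.tgt (M.next d) = M.apex d := by rw [← src_next, apex]

theorem tgt_next_next (d : D) : M.tgt (M.next (M.next d)) = M.src d := by
  rw [← src_next, M.next_next_next]

theorem src_rot_iterate (d : D) (n : ℕ) : M.src (M.rot^[n] d) = M.src d := by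
  induction n with
  | zero => rfl
  | succ n ih => rw [Function.iterate_succ_apply', src_rot, ih]

theorem exists_rot_iterate_of_src_eq {d e : D} (h : M.src d = M.src e) : ∃ n, M.rot^[n] d = e :=
  (M.src_eq_iff d e).1 h

theorem mem_star {v : V} {d : D} : d ∈ M.star v ↔ M.src d = v := by simp [star]

/-- A function of darts that is invariant under rotation about the source is a function of the
source. -/
theorem eq_of_src_eq {X : Type*} {g : D → X} (hg : ∀ d, g (M.rot d) = g d) {d e : D}
    (h : M.src d = M.src e) : g e = g d := by
  obtain ⟨n, rfl⟩ := M.exists_rot_iterate_of_src_eq h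
  clear h
  induction n with
  | zero => rfl
  | succ n ih => rw [Function.iterate_succ_apply', hg, ih]

theorem exists_rot_iterate_self (d : D) : ∃ n, 0 < n ∧ M.rot^[n] d = d := by
  obtain ⟨n, hn⟩ := M.exists_rot_iterate_of_src_eq (M.src_rot d)
  exact ⟨n + 1, Nat.succ_pos _, by rwa [Function.iterate_succ_apply]⟩

/-- The star is a single orbit of `rot`, and one minimal period visits each of its darts exactly
once. -/
theorem sum_star_eq_sum_range {A : Type*} [AddCommMonoid A] (g : D → A) (d : D) :
    ∑ e ∈ M.star (M.src d), g e =
      ∑ k ∈ Finset.range (Function.minimalPeriod M.rot d), g (M.rot^[k] d) := by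
  classical
  have hper : d ∈ Function.periodicPts M.rot := by
    obtain ⟨n, hn, h⟩ := M.exists_rot_iterate_self d
    exact ⟨n, hn, h⟩
  have hpos := Function.minimalPeriod_pos_of_mem_periodicPts hper
  have himg : M.star (M.src d) =
      (Finset.range (Function.minimalPeriod M.rot d)).image (fun k => M.rot^[k] d) := by
    ext e
    rw [mem_star, Finset.mem_image]
    constructor
    · intro h
      obtain ⟨n, hn⟩ := M.exists_rot_iterate_of_src_eq h.symm
      refine ⟨n % Function.minimalPeriod M.rot d, Finset.mem_range.2 (Nat.mod_lt _ hpos), ?_⟩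
      rw [Function.iterate_mod_minimalPeriod_eq, hn]
    · rintro ⟨n, -, rfl⟩
      exact M.src_rot_iterate d n
  rw [himg, Finset.sum_image]
  intro a ha b hb hab
  exact Function.iterate_injOn_Iio_minimalPeriod (Finset.mem_range.1 ha) (Finset.mem_range.1 hb) hab

/-- If the sum of `g` over the star of a vertex vanishes, so do its sums over closed walks around
the vertex. -/
theorem sum_range_rot_eq_zero {A : Type*} [AddCommMonoid A] {g : D → A} {d : D}
    (hg : ∑ e ∈ M.star (M.src d), g e = 0) {n : ℕ} (hn : M.rot^[n] d = d) :
    ∑ k ∈ Finset.range n, g (M.rot^[k] d) = 0 := by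
  rw [sum_star_eq_sum_range] at hg
  -- A closed walk around the vertex winds `q` full times.
  obtain ⟨q, rfl⟩ := Function.IsPeriodicPt.minimalPeriod_dvd (f := M.rot) hn
  clear hn
  induction q with
  | zero => simp
  | succ q ih =>
    rw [Nat.mul_succ, Finset.sum_range_add, ih, zero_add, ← hg]
    refine Finset.sum_congr rfl fun k _ => ?_
    rw [add_comm, Function.iterate_add_apply, Function.iterate_mul,
      Function.iterate_fixed Function.iterate_minimalPeriod]

/-! ### Dual paths and multiplicative one-forms -/

variable {M}

theorem IsDualPath.append {φ ψ χ : F} {p q : List D} (hp : M.IsDualPath φ p ψ)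
    (hq : M.IsDualPath ψ q χ) : M.IsDualPath φ (p ++ q) χ := by
  induction p generalizing φ with
  | nil => cases hp; exact hq
  | cons d p ih => exact ⟨hp.1, ih hp.2⟩

theorem isDualPath_singleton (d : D) : M.IsDualPath (M.face d) [d] (M.face (M.rev d)) :=
  ⟨rfl, rfl⟩

variable {G : Type*} [Group G]

/-- The product of the values of a multiplicative one-form along a dual path. -/
def holonomy (R : D → G) : List D → G
  | [] => 1
  | d :: p => holonomy R p * R d

theorem holonomy_append (R : D → G) (p q : List D) :
    holonomy R (p ++ q) = holonomy R q * holonomy R p := by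
  induction p with
  | nil => simp [holonomy]
  | cons d p ih => simp [holonomy, ih, mul_assoc]

theorem holonomy_eq_of_homotopic {R : D → G} (hrev : ∀ d, R (M.rev d) * R d = 1)
    (hloop : ∀ d n, M.rot^[n] d = d →
      holonomy R ((List.range n).map fun k => M.rot^[k] d) = 1)
    {φ ψ : F} {p q : List D} (h : M.DualHomotopic φ ψ p q) : holonomy R p = holonomy R q := by
  induction h with
  | rel p q h =>
    obtain ⟨-, -, h⟩ := h
    cases h with
    | backtrack p q d => 
      simp only [holonomy_append, holonomy, one_mul]
      rw [hrev, one_mul]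
    | around p q d n h => rw [holonomy_append, holonomy_append, holonomy_append, hloop d n h, one_mul]
  | refl => rfl
  | symm _ _ _ ih => exact ih.symm
  | trans _ _ _ _ _ h₁ h₂ => exact h₁.trans h₂

/-- On a simply connected surface a closed multiplicative one-form is exact. -/
theorem IsSimplyConnected.exists_primitive (hM : M.IsSimplyConnected) {R : D → G}
    (hrev : ∀ d, R (M.rev d) * R d = 1)
    (hloop : ∀ d n, M.rot^[n] d = d →
      holonomy R ((List.range n).map fun k => M.rot^[k] d) = 1) (φ₀ : F) (a : G) :
    ∃ A : F → G, A φ₀ = a ∧ ∀ d, A (M.face (M.rev d)) = R d * A (M.face d) := by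
  have hclosed : ∀ φ p, M.IsDualPath φ p φ → holonomy R p = 1 := fun φ p hp =>
    holonomy_eq_of_homotopic hrev hloop (hM.2 φ p hp)
  choose p hp using hM.1 φ₀
  refine ⟨fun φ => holonomy R (p φ) * a, ?_, fun d => ?_⟩
  · simp [hclosed φ₀ _ (hp φ₀)]
  -- Closing both paths to `face (rev d)` by the same return path `q` gives two loops with trivial
  -- holonomy; cancelling `q` compares the paths.
  · obtain ⟨q, hq⟩ := hM.1 (M.face (M.rev d)) φ₀
    have h₁ := hclosed _ _ (((hp (M.face d)).append (isDualPath_singleton d)).append hq)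
    have h₂ := hclosed _ _ ((hp (M.face (M.rev d))).append hq)
    rw [← h₁] at h₂
    simp only [holonomy_append, holonomy, one_mul] at h₂
    simp only [mul_left_cancel h₂, mul_assoc]

/-- To extend a property of dual vertices along the surface it suffices to cross edges. -/
theorem IsSimplyConnected.face_induction (hM : M.IsSimplyConnected) {Q : F → Prop} {φ₀ : F}
    (h₀ : Q φ₀) (hstep : ∀ d, Q (M.face d) → Q (M.face (M.rev d))) (φ : F) : Q φ := by
  obtain ⟨p, hp⟩ := hM.1 φ₀ φ
  induction p generalizing φ₀ with
  | nil => cases hp; exact h₀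
  | cons d p ih =>
    obtain ⟨rfl, hp⟩ := hp
    exact ih (hstep d h₀) hp

/-- Every face is reached from `φ₀` by a finite word recording which side to cross at each stage.
Countability is what later allows all vertices to be moved off infinity at once. -/
theorem IsSimplyConnected.countable_darts (hM : M.IsSimplyConnected) : Countable D := by
  rcases isEmpty_or_nonempty F with hF | ⟨⟨φ₀⟩⟩
  · have : IsEmpty D := ⟨fun d => hF.elim (M.face d)⟩
    infer_instance
  let side : F → ℕ → D := fun φ k => M.next^[k] (Function.surjInv M.face_surjective φ)
  have hside : ∀ d, ∃ k, side (M.face d) k = d := fun d => by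
    rcases (M.face_eq_iff (Function.surjInv M.face_surjective (M.face d)) d).1
      (Function.surjInv_eq M.face_surjective (M.face d)) with h | h | h
    exacts [⟨0, h.symm⟩, ⟨1, h.symm⟩, ⟨2, h.symm⟩]
  have hF : Function.Surjective fun l : List ℕ =>
      l.foldr (fun k φ => M.face (M.rev (side φ k))) φ₀ := by
    refine hM.face_induction (φ₀ := φ₀) ⟨[], rfl⟩ ?_
    rintro d ⟨l, hl⟩
    obtain ⟨k, hk⟩ := hside d
    refine ⟨k :: l, ?_⟩
    simp only [List.foldr_cons] at hl ⊢
    rw [hl, hk]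
  have := hF.countable
  have hD : Function.Surjective fun x : F × ℕ => side x.1 x.2 := fun d =>
    let ⟨k, hk⟩ := hside d
    ⟨(M.face d, k), hk⟩
  exact hD.countable

end SurfaceTriangulation

/-! ### Horospheres and matrices in `SL(2, ℂ)` -/

/-- The factor in the definition of `horoVec`. -/
noncomputable def horoScale (w : ℂ) (r : ℝ) : ℝ := 2 * r / (1 + ‖w‖ ^ 2)

theorem horoScale_pos (w : ℂ) {r : ℝ} (hr : 0 < r) : 0 < horoScale w r := by
  unfold horoScale; positivity

/-- The matrix whose columns represent the light vectors of two horospheres. -/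
noncomputable def edgeFrame (w₁ : ℂ) (r₁ : ℝ) (w₂ : ℂ) (r₂ : ℝ) : Mat2 :=
  !![(Real.sqrt (horoScale w₁ r₁) : ℂ) * w₁, (Real.sqrt (horoScale w₂ r₂) : ℂ) * w₂;
    (Real.sqrt (horoScale w₁ r₁) : ℂ), (Real.sqrt (horoScale w₂ r₂) : ℂ)]

theorem horoVec_eq (w : ℂ) (r : ℝ) :
    horoVec w r = (horoScale w r : ℂ) • hermMat (Complex.normSq w) 1 w := by
  rw [horoVec, hermMat, Complex.normSq_eq_norm_sq, horoScale, Complex.ofReal_one]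

theorem isHermitian_horoVec (w : ℂ) (r : ℝ) : (horoVec w r).IsHermitian := by
  rw [horoVec_eq, ofReal_smul_hermMat]
  exact isHermitian_hermMat _ _ _

/-- A light vector has rank one: it is `v * vᴴ` for `v` the corresponding column of the frame. -/
theorem horoVec_eq_left {w₁ : ℂ} {r₁ : ℝ} (w₂ : ℂ) (r₂ : ℝ) (h : 0 < r₁) :
    horoVec w₁ r₁ = hermCong (edgeFrame w₁ r₁ w₂ r₂) (hermMat 1 0 0) := by
  have hs : (Real.sqrt (horoScale w₁ r₁) : ℂ) * Real.sqrt (horoScale w₁ r₁) = horoScale w₁ r₁ := by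
    exact_mod_cast Real.mul_self_sqrt (horoScale_pos w₁ h).le
  rw [horoVec_eq, ← hs]
  ext i j
  fin_cases i <;> fin_cases j <;>
    simp [hermCong, edgeFrame, hermMat, Matrix.mul_apply, ← Complex.mul_conj] <;> ring

theorem horoVec_eq_right (w₁ : ℂ) (r₁ : ℝ) {w₂ : ℂ} {r₂ : ℝ} (h : 0 < r₂) :
    horoVec w₂ r₂ = hermCong (edgeFrame w₁ r₁ w₂ r₂) (hermMat 0 1 0) := by
  have hs : (Real.sqrt (horoScale w₂ r₂) : ℂ) * Real.sqrt (horoScale w₂ r₂) = horoScale w₂ r₂ := by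
    exact_mod_cast Real.mul_self_sqrt (horoScale_pos w₂ h).le
  rw [horoVec_eq, ← hs]
  ext i j
  fin_cases i <;> fin_cases j <;>
    simp [hermCong, edgeFrame, hermMat, Matrix.mul_apply, ← Complex.mul_conj] <;> ring

theorem det_edgeFrame (w₁ : ℂ) (r₁ : ℝ) (w₂ : ℂ) (r₂ : ℝ) : (edgeFrame w₁ r₁ w₂ r₂).det =
    Real.sqrt (horoScale w₁ r₁) * Real.sqrt (horoScale w₂ r₂) * (w₁ - w₂) := by
  rw [edgeFrame, Matrix.det_fin_two_of]; ring

theorem det_edgeFrame_ne_zero {w₁ w₂ : ℂ} {r₁ r₂ : ℝ} (h₁ : 0 < r₁) (h₂ : 0 < r₂) (hw : w₁ ≠ w₂) :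
    (edgeFrame w₁ r₁ w₂ r₂).det ≠ 0 := by
  rw [det_edgeFrame]
  have h1 := (Real.sqrt_pos.2 (horoScale_pos w₁ h₁)).ne'
  have h2 := (Real.sqrt_pos.2 (horoScale_pos w₂ h₂)).ne'
  have := sub_ne_zero.2 hw
  simp [h1, h2, this]

theorem normSq_det_edgeFrame {w₁ w₂ : ℂ} {r₁ r₂ : ℝ} (h₁ : 0 < r₁) (h₂ : 0 < r₂) :
    Complex.normSq (edgeFrame w₁ r₁ w₂ r₂).det =
      horoScale w₁ r₁ * horoScale w₂ r₂ * Complex.normSq (w₁ - w₂) := by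
  rw [det_edgeFrame, Complex.normSq_mul, Complex.normSq_mul, Complex.normSq_ofReal,
    Complex.normSq_ofReal, Real.mul_self_sqrt (horoScale_pos _ h₁).le,
    Real.mul_self_sqrt (horoScale_pos _ h₂).le]

theorem mink_horoVec {w₁ w₂ : ℂ} {r₁ r₂ : ℝ} (h₁ : 0 < r₁) (h₂ : 0 < r₂) :
    mink (horoVec w₁ r₁) (horoVec w₂ r₂) =
      -(Complex.normSq (edgeFrame w₁ r₁ w₂ r₂).det / 2) := by
  rw [horoVec_eq_left w₂ r₂ h₁, horoVec_eq_right w₁ r₁ h₂, mink_frame]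

/-! ### Matrices acting on lifts of boundary points -/

theorem mulVec_lift_iff {A : Mat2} {z w c : ℂ} :
    A *ᵥ ![z, 1] = c • ![w, 1] ↔ A 0 0 * z + A 0 1 = c * w ∧ A 1 0 * z + A 1 1 = c := by
  constructor
  · intro h
    have h0 := congr_fun h 0
    have h1 := congr_fun h 1
    simp [Matrix.mulVec, dotProduct, Fin.sum_univ_two] at h0 h1
    exact ⟨h0, h1⟩
  · rintro ⟨h0, h1⟩
    ext i
    fin_cases i <;> simp [Matrix.mulVec, dotProduct, Fin.sum_univ_two, h0, h1]

/-- In the frame of its eigenvectors `Q` becomes `diag (lam, mu)`. Unimodular eigenvalues keep the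
diagonal, so `Q` acts as a rotation of the off-diagonal entry about the geodesic between the
tangency points. -/
theorem hermCong_eigen {Q : Mat2} {w₁ w₂ lam mu : ℂ} (r₁ r₂ : ℝ)
    (h₁ : Q *ᵥ ![w₁, 1] = lam • ![w₁, 1]) (h₂ : Q *ᵥ ![w₂, 1] = mu • ![w₂, 1])
    (hl : ‖lam‖ = 1) (hm : ‖mu‖ = 1) (a b : ℝ) (β : ℂ) :
    hermCong Q (hermCong (edgeFrame w₁ r₁ w₂ r₂) (hermMat a b β)) =
      hermCong (edgeFrame w₁ r₁ w₂ r₂) (hermMat a b (lam * conj mu * β)) := by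
  obtain ⟨h10, h11⟩ := mulVec_lift_iff.1 h₁
  obtain ⟨h20, h21⟩ := mulVec_lift_iff.1 h₂
  have hQ : Q * edgeFrame w₁ r₁ w₂ r₂ = edgeFrame w₁ r₁ w₂ r₂ * !![lam, 0; 0, mu] := by
    ext i j
    fin_cases i <;> fin_cases j <;> simp [edgeFrame, Matrix.mul_apply, Fin.sum_univ_two]
    · linear_combination (Real.sqrt (horoScale w₁ r₁) : ℂ) * h10
    · linear_combination (Real.sqrt (horoScale w₂ r₂) : ℂ) * h20
    · linear_combination (Real.sqrt (horoScale w₁ r₁) : ℂ) * h11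
    · linear_combination (Real.sqrt (horoScale w₂ r₂) : ℂ) * h21
  rw [hermCong_hermCong, hQ, ← hermCong_hermCong]
  congr 1
  have hl' : lam * conj lam = 1 := by rw [Complex.mul_conj, Complex.normSq_eq_norm_sq, hl]; simp
  have hm' : mu * conj mu = 1 := by rw [Complex.mul_conj, Complex.normSq_eq_norm_sq, hm]; simp
  ext i j
  fin_cases i <;> fin_cases j <;> simp [hermCong, hermMat, Matrix.mul_apply, Fin.sum_univ_two]
  · linear_combination (a : ℂ) * hl'
  · ring
  · ring
  · linear_combination (b : ℂ) * hm'

/-- The edge data of a horospherical net produced by an elliptic Möbius transformation. -/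
theorem exists_arc_of_rotation {w₁ w₂ : ℂ} {r₁ r₂ : ℝ} (h₁ : 0 < r₁) (h₂ : 0 < r₂) (hw : w₁ ≠ w₂)
    {x : Mat2} (hx₁ : x ∈ horosphere (horoVec w₁ r₁)) (hx₂ : x ∈ horosphere (horoVec w₂ r₂))
    (hm : -2 < mink (horoVec w₁ r₁) (horoVec w₂ r₂)) {Q : Mat2} {lam mu : ℂ}
    (hQ₁ : Q *ᵥ ![w₁, 1] = lam • ![w₁, 1]) (hQ₂ : Q *ᵥ ![w₂, 1] = mu • ![w₂, 1])
    (hl : ‖lam‖ = 1) (hmu : ‖mu‖ = 1) {δ : ℝ} (hδ : |δ| < Real.pi)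
    (hlm : lam * conj mu = Complex.exp (-δ * Complex.I)) {α : ℝ}
    (hα : α = (if 0 ≤ δ then 1 else -1) *
      Real.arccos (1 + mink (horoVec w₁ r₁) (horoVec w₂ r₂))) :
    ∃ T, IsShortArc (horoVec w₁ r₁) (horoVec w₂ r₂) x (hermCong Q x) T |δ| ∧
      α ∈ Set.Ioo (-Real.pi) Real.pi ∧
      Real.cos α = mink (horoNormal (horoVec w₁ r₁) x) (horoNormal (horoVec w₂ r₂) x) ∧
      Real.sin α = minkVol x (horoNormal (horoVec w₁ r₁) x) (horoNormal (horoVec w₂ r₂) x) T ∧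
      |δ| * circRadius (horoVec w₁ r₁) (horoVec w₂ r₂) x * Real.tan (α / 2) = δ := by
  rw [mink_horoVec h₁ h₂] at hm hα
  have hP := det_edgeFrame_ne_zero h₁ h₂ hw
  rw [horoVec_eq_left w₂ r₂ h₁] at hx₁ ⊢
  rw [horoVec_eq_right w₁ r₁ h₂] at hx₂ ⊢
  obtain ⟨β, rfl, -⟩ := exists_frame_of_mem hP hx₁ hx₂
  rw [hermCong_eigen r₁ r₂ hQ₁ hQ₂ hl hmu, hlm]
  exact exists_isShortArc hP (by linarith) hx₁ hx₂ hδ (by rw [hα, sub_eq_add_neg])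

/-- The elliptic Möbius transformation along an edge of a horospherical net. -/
theorem IsShortArc.hermCong_eq {w₁ w₂ : ℂ} {r₁ r₂ : ℝ} (h₁ : 0 < r₁) (h₂ : 0 < r₂) (hw : w₁ ≠ w₂)
    {x y T : Mat2} (hx₁ : x ∈ horosphere (horoVec w₁ r₁)) (hx₂ : x ∈ horosphere (horoVec w₂ r₂))
    {τ α : ℝ} (hT : IsShortArc (horoVec w₁ r₁) (horoVec w₂ r₂) x y T τ)
    (hα : α ∈ Set.Ioo (-Real.pi) Real.pi)
    (hcos : Real.cos α = mink (horoNormal (horoVec w₁ r₁) x) (horoNormal (horoVec w₂ r₂) x))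
    (hsin : Real.sin α =
      minkVol x (horoNormal (horoVec w₁ r₁) x) (horoNormal (horoVec w₂ r₂) x) T) :
    -2 < mink (horoVec w₁ r₁) (horoVec w₂ r₂) ∧ ∀ (Q : Mat2) (lam mu : ℂ),
      Q *ᵥ ![w₁, 1] = lam • ![w₁, 1] → Q *ᵥ ![w₂, 1] = mu • ![w₂, 1] → ‖lam‖ = 1 → ‖mu‖ = 1 →
      lam * conj mu = Complex.exp (-(τ * circRadius (horoVec w₁ r₁) (horoVec w₂ r₂) x *
        Real.tan (α / 2) : ℝ) * Complex.I) → hermCong Q x = y := by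
  rw [mink_horoVec h₁ h₂]
  have hP := det_edgeFrame_ne_zero h₁ h₂ hw
  rw [horoVec_eq_left w₂ r₂ h₁] at *
  rw [horoVec_eq_right w₁ r₁ h₂] at *
  obtain ⟨hm, β, -, hx, hy⟩ := hT.rotation hP hx₁ hx₂ hα hcos hsin
  refine ⟨by linarith, fun Q lam mu hQ₁ hQ₂ hl hmu hlm => ?_⟩
  rw [← hlm] at hy
  rw [hy, ← hermCong_eigen r₁ r₂ hQ₁ hQ₂ hl hmu, ← hx]

/-- Horospheres that are not tangent meet away from the geodesic between their tangency points: the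
off-diagonal entry of `x` is nonzero and therefore detects the rotation. -/
theorem eigen_ratio_eq_one {w₁ w₂ : ℂ} {r₁ r₂ : ℝ} (h₁ : 0 < r₁) (h₂ : 0 < r₂) (hw : w₁ ≠ w₂)
    {x : Mat2} (hx₁ : x ∈ horosphere (horoVec w₁ r₁)) (hx₂ : x ∈ horosphere (horoVec w₂ r₂))
    (hm : -2 < mink (horoVec w₁ r₁) (horoVec w₂ r₂)) {Q : Mat2} {lam mu : ℂ}
    (hQ₁ : Q *ᵥ ![w₁, 1] = lam • ![w₁, 1]) (hQ₂ : Q *ᵥ ![w₂, 1] = mu • ![w₂, 1])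
    (hl : ‖lam‖ = 1) (hmu : ‖mu‖ = 1) (hx : hermCong Q x = x) : lam * conj mu = 1 := by
  rw [mink_horoVec h₁ h₂] at hm
  have hP := det_edgeFrame_ne_zero h₁ h₂ hw
  rw [horoVec_eq_left w₂ r₂ h₁] at hx₁
  rw [horoVec_eq_right w₁ r₁ h₂] at hx₂
  obtain ⟨β, rfl, hβ⟩ := exists_frame_of_mem hP hx₁ hx₂
  rw [hermCong_eigen r₁ r₂ hQ₁ hQ₂ hl hmu] at hx
  have h := (hermMat_inj (hermCong_injective hP hx)).2.2
  have hpos : 0 < Complex.normSq (edgeFrame w₁ r₁ w₂ r₂).det := Complex.normSq_pos.2 hP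
  have hβ0 : β ≠ 0 := by
    rintro rfl
    rw [map_zero] at hβ
    field_simp at hβ
    linarith
  exact mul_right_cancel₀ hβ0 (by rw [h, one_mul])

/-- The difference `z₁ - z₂` is the determinant of the two lifts, which `A` preserves. -/
theorem sub_eq_of_mulVec_lift {A : Mat2} (hA : A.det = 1) {z₁ z₂ w₁ w₂ c₁ c₂ : ℂ}
    (h₁ : A *ᵥ ![z₁, 1] = c₁ • ![w₁, 1]) (h₂ : A *ᵥ ![z₂, 1] = c₂ • ![w₂, 1]) :
    z₁ - z₂ = c₁ * c₂ * (w₁ - w₂) := by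
  obtain ⟨h10, h11⟩ := mulVec_lift_iff.1 h₁
  obtain ⟨h20, h21⟩ := mulVec_lift_iff.1 h₂
  rw [Matrix.det_fin_two] at hA
  linear_combination (-(z₁ - z₂)) * hA + (A 1 0 * z₂ + A 1 1) * h10 - (A 1 0 * z₁ + A 1 1) * h20
    + c₁ * w₁ * h21 - c₂ * w₂ * h11

theorem mink_smul_right (X Y : Mat2) (c : ℝ) : mink X ((c : ℂ) • Y) = c * mink X Y := by
  rw [mink, mink, ← Complex.re_ofReal_mul]
  congr 1
  simp [Matrix.adjugate_fin_two, Matrix.trace_fin_two, Matrix.mul_apply, Fin.sum_univ_two]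
  ring

/-- Congruence by `A` maps the light vector of `z` to `normSq c` times that of `w`, so invariance of
the form moves the computation to the base point `1`. -/
theorem normSq_mul_mink_horoVec {A : Mat2} (hA : A.det = 1) {z w c : ℂ}
    (h : A *ᵥ ![z, 1] = c • ![w, 1]) (r : ℝ) :
    Complex.normSq c * mink (A * Aᴴ) (horoVec w r) =
      -(horoScale w r * (1 + Complex.normSq z) / 2) := by
  obtain ⟨h0, h1⟩ := mulVec_lift_iff.1 h
  have key : (Complex.normSq c : ℂ) • hermMat (Complex.normSq w) 1 w =
      hermCong A (hermMat (Complex.normSq z) 1 z) := by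
    have hc0 := congr_arg conj h0
    have hc1 := congr_arg conj h1
    simp only [map_add, map_mul] at hc0 hc1
    ext i j
    fin_cases i <;> fin_cases j <;>
      simp [hermCong, hermMat, Matrix.mul_apply, Fin.sum_univ_two, ← Complex.mul_conj]
    · linear_combination (-(c * w)) * hc0 - (conj (A 0 0) * conj z + conj (A 0 1)) * h0
    · linear_combination (-(c * w)) * hc1 - (conj (A 1 0) * conj z + conj (A 1 1)) * h0
    · linear_combination (-c) * hc0 - (conj (A 0 0) * conj z + conj (A 0 1)) * h1
    · linear_combination (-c) * hc1 - (conj (A 1 0) * conj z + conj (A 1 1)) * h1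
  rw [horoVec_eq, mink_smul_right, mul_left_comm, ← mink_smul_right, key, ← hermCong_one_right,
    mink_hermCong, hA, show (1 : Mat2) = hermMat 1 1 0 by
      ext i j; fin_cases i <;> fin_cases j <;> simp [hermMat], mink_hermMat]
  simp
  ring

theorem mul_conj_ne_neg_one_iff (z₁ z₂ : ℂ) : z₁ * conj z₂ ≠ -1 ↔
    Complex.normSq (z₁ - z₂) < (1 + Complex.normSq z₁) * (1 + Complex.normSq z₂) := by
  -- Lagrange's identity for the lifts `(z₁, 1)` and `(z₂, 1)`.
  have key : (1 + Complex.normSq z₁) * (1 + Complex.normSq z₂) =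
      Complex.normSq (z₁ - z₂) + Complex.normSq (z₁ * conj z₂ + 1) := by
    simp only [Complex.normSq_apply, Complex.sub_re, Complex.sub_im, Complex.add_re,
      Complex.add_im, Complex.mul_re, Complex.mul_im, Complex.conj_re, Complex.conj_im,
      Complex.one_re, Complex.one_im]
    ring
  rw [key, lt_add_iff_pos_right, Complex.normSq_pos, Ne, Ne, ← eq_neg_iff_add_eq_zero]

/-- The horospheres over an edge are tangent if and only if the preimages of their tangency points
are antipodal. -/
theorem neg_two_lt_mink_horoVec_iff {A : Mat2} (hA : A.det = 1) {z₁ z₂ w₁ w₂ c₁ c₂ : ℂ}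
    (hA₁ : A *ᵥ ![z₁, 1] = c₁ • ![w₁, 1]) (hA₂ : A *ᵥ ![z₂, 1] = c₂ • ![w₂, 1])
    {r₁ r₂ : ℝ} (h₁ : 0 < r₁) (h₂ : 0 < r₂)
    (hx₁ : mink (A * Aᴴ) (horoVec w₁ r₁) = -1) (hx₂ : mink (A * Aᴴ) (horoVec w₂ r₂) = -1) :
    -2 < mink (horoVec w₁ r₁) (horoVec w₂ r₂) ↔ z₁ * conj z₂ ≠ -1 := by
  have e₁ := normSq_mul_mink_horoVec hA hA₁ r₁
  have e₂ := normSq_mul_mink_horoVec hA hA₂ r₂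
  rw [hx₁] at e₁
  rw [hx₂] at e₂
  have hz₁ : 0 < 1 + Complex.normSq z₁ := by linarith [Complex.normSq_nonneg z₁]
  have hz₂ : 0 < 1 + Complex.normSq z₂ := by linarith [Complex.normSq_nonneg z₂]
  have s₁ : horoScale w₁ r₁ = 2 * Complex.normSq c₁ / (1 + Complex.normSq z₁) := by
    field_simp; linarith
  have s₂ : horoScale w₂ r₂ = 2 * Complex.normSq c₂ / (1 + Complex.normSq z₂) := by
    field_simp; linarith
  rw [mul_conj_ne_neg_one_iff, mink_horoVec h₁ h₂, normSq_det_edgeFrame h₁ h₂, s₁, s₂,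
    sub_eq_of_mulVec_lift hA hA₁ hA₂, Complex.normSq_mul, Complex.normSq_mul, neg_lt_neg_iff,
    ← sub_pos, ← sub_pos (a := (1 + Complex.normSq z₁) * (1 + Complex.normSq z₂)),
    show (2 : ℝ) - 2 * Complex.normSq c₁ / (1 + Complex.normSq z₁) *
      (2 * Complex.normSq c₂ / (1 + Complex.normSq z₂)) * Complex.normSq (w₁ - w₂) / 2 =
      2 / ((1 + Complex.normSq z₁) * (1 + Complex.normSq z₂)) *
      ((1 + Complex.normSq z₁) * (1 + Complex.normSq z₂) -
        Complex.normSq c₁ * Complex.normSq c₂ * Complex.normSq (w₁ - w₂)) by field_simp]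
  exact mul_pos_iff_of_pos_left (by positivity)

theorem eq_of_mulVec_lift_eq {Q Q' : Mat2} {w₁ w₂ : ℂ} (hw : w₁ ≠ w₂)
    (h₁ : Q *ᵥ ![w₁, 1] = Q' *ᵥ ![w₁, 1]) (h₂ : Q *ᵥ ![w₂, 1] = Q' *ᵥ ![w₂, 1]) : Q = Q' := by
  have h := sub_ne_zero.2 hw
  have a0 := congr_fun h₁ 0
  have a1 := congr_fun h₁ 1
  have b0 := congr_fun h₂ 0
  have b1 := congr_fun h₂ 1
  simp [Matrix.mulVec, dotProduct, Fin.sum_univ_two] at a0 a1 b0 b1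
  have e0 : Q 0 0 = Q' 0 0 := mul_left_cancel₀ h (by linear_combination a0 - b0)
  have e1 : Q 1 0 = Q' 1 0 := mul_left_cancel₀ h (by linear_combination a1 - b1)
  rw [e0] at a0
  rw [e1] at a1
  ext i j
  fin_cases i <;> fin_cases j
  exacts [e0, add_left_cancel a0, e1, add_left_cancel a1]

theorem exists_specialLinear_eigen {w₁ w₂ lam : ℂ} (hw : w₁ ≠ w₂) (hl : lam ≠ 0) :
    ∃ Q : Matrix.SpecialLinearGroup (Fin 2) ℂ,
      (Q : Mat2) *ᵥ ![w₁, 1] = lam • ![w₁, 1] ∧ (Q : Mat2) *ᵥ ![w₂, 1] = lam⁻¹ • ![w₂, 1] := by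
  have h := sub_ne_zero.2 hw
  refine ⟨⟨!![(lam * w₁ - lam⁻¹ * w₂) / (w₁ - w₂), (lam⁻¹ - lam) * w₁ * w₂ / (w₁ - w₂);
    (lam - lam⁻¹) / (w₁ - w₂), (lam⁻¹ * w₁ - lam * w₂) / (w₁ - w₂)], ?_⟩, ?_, ?_⟩
  · rw [Matrix.det_fin_two_of]
    field_simp
    ring
  · rw [mulVec_lift_iff]
    constructor <;> simp <;> field_simp <;> ring
  · rw [mulVec_lift_iff]
    constructor <;> simp <;> field_simp <;> ring

/-! ### Points of hyperbolic space as products `A * Aᴴ` -/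

theorem mul_conjTranspose_mem_hyperbolicSpace {A : Mat2} (hA : A.det = 1) :
    A * Aᴴ ∈ hyperbolicSpace := by
  refine ⟨Matrix.isHermitian_mul_conjTranspose_self A, ?_, ?_⟩
  · rw [Matrix.det_mul, Matrix.det_conjTranspose, hA]; simp
  · have h : (A * Aᴴ).trace.re = Complex.normSq (A 0 0) + Complex.normSq (A 0 1) +
        Complex.normSq (A 1 0) + Complex.normSq (A 1 1) := by
      simp [Matrix.trace_fin_two, Matrix.mul_apply, Fin.sum_univ_two, Complex.mul_conj]
      ring
    have h0 := Complex.normSq_nonneg (A 0 0)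
    have h1 := Complex.normSq_nonneg (A 0 1)
    have h2 := Complex.normSq_nonneg (A 1 0)
    have h3 := Complex.normSq_nonneg (A 1 1)
    rw [h]
    by_contra hle
    have e0 : A 0 0 = 0 := Complex.normSq_eq_zero.1 (by linarith)
    have e1 : A 0 1 = 0 := Complex.normSq_eq_zero.1 (by linarith)
    rw [Matrix.det_fin_two, e0, e1] at hA
    simp at hA

theorem exists_mul_conjTranspose_eq {x : Mat2} (hx : x ∈ hyperbolicSpace) :
    ∃ A : Matrix.SpecialLinearGroup (Fin 2) ℂ, (A : Mat2) * (A : Mat2)ᴴ = x := by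
  obtain ⟨hh, hd, ht⟩ := hx
  obtain ⟨a, b, β, rfl⟩ := exists_eq_hermMat hh
  rw [det_hermMat] at hd
  have hd' : a * b - Complex.normSq β = 1 := by exact_mod_cast hd
  have ht' : 0 < a + b := by simpa [hermMat, Matrix.trace_fin_two] using ht
  have ha : 0 < a := by
    by_contra hle
    nlinarith [Complex.normSq_nonneg β]
  have hs : 0 < Real.sqrt a := Real.sqrt_pos.2 ha
  have hsC : (Real.sqrt a : ℂ) ≠ 0 := by exact_mod_cast hs.ne'
  have hs2 : (Real.sqrt a : ℂ) ^ 2 = a := by exact_mod_cast Real.sq_sqrt ha.le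
  -- The lower triangular Cholesky factor.
  refine ⟨⟨!![(Real.sqrt a : ℂ), 0; conj β / Real.sqrt a, (Real.sqrt a : ℂ)⁻¹], ?_⟩, ?_⟩
  · rw [Matrix.det_fin_two_of, zero_mul, sub_zero, mul_inv_cancel₀ hsC]
  · ext i j
    fin_cases i <;> fin_cases j <;> simp [hermMat, Matrix.mul_apply, Fin.sum_univ_two]
    · rw [← sq, hs2]
    · field_simp
    · field_simp
    · field_simp
      rw [hs2, mul_comm, Complex.mul_conj]
      norm_cast
      linarith

open scoped ComplexOrder in
/-- A parabolic isometry of hyperbolic space has no fixed point. -/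
theorem eq_one_of_hermCong_eq {Q x : Mat2} (hQ : Q.det = 1) {w : ℂ}
    (h : Q *ᵥ ![w, 1] = ![w, 1]) (hx : x ∈ hyperbolicSpace) (hQx : hermCong Q x = x) : Q = 1 := by
  obtain ⟨A, rfl⟩ := exists_mul_conjTranspose_eq hx
  set N : Mat2 := Q - 1 with hN
  have hQN : Q = 1 + N := by rw [hN]; abel
  obtain ⟨h0, h1⟩ := mulVec_lift_iff.1 (show Q *ᵥ ![w, 1] = (1 : ℂ) • ![w, 1] by rw [h, one_smul])
  rw [Matrix.det_fin_two] at hQ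
  -- With eigenvalue one and determinant one, the other eigenvalue is one as well; hence `N` is
  -- nilpotent.
  have htr : Q 0 0 + Q 1 1 = 2 := by
    linear_combination hQ + Q 1 0 * h0 + (1 - Q 0 0) * h1
  have hNN : N * N = 0 := by
    ext i j
    fin_cases i <;> fin_cases j <;> simp [hN, Matrix.mul_apply, Fin.sum_univ_two]
    · linear_combination Q 0 0 * htr - hQ
    · linear_combination Q 0 1 * htr
    · linear_combination Q 1 0 * htr
    · linear_combination Q 1 1 * htr - hQ
  set x : Mat2 := (A : Mat2) * (A : Mat2)ᴴ with hxdef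
  have hsum : N * x + x * Nᴴ + N * x * Nᴴ = 0 := by
    have e : hermCong Q x = x + (N * x + x * Nᴴ + N * x * Nᴴ) := by
      rw [hermCong, hQN, Matrix.conjTranspose_add, Matrix.conjTranspose_one]
      noncomm_ring
    rw [hQx] at e
    exact left_eq_add.1 e
  have hzero : N * x * Nᴴ = 0 := by
    have e : N * (N * x + x * Nᴴ + N * x * Nᴴ) = N * N * x + N * x * Nᴴ + N * N * x * Nᴴ := by
      noncomm_ring
    rw [hsum, hNN] at e
    simpa using e.symm
  -- Here `N * x * Nᴴ` is `(N * A) * (N * A)ᴴ`, which vanishes only if `N * A` does.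
  have hNA : N * (A : Mat2) = 0 := by
    rw [← Matrix.self_mul_conjTranspose_eq_zero, Matrix.conjTranspose_mul, ← hzero, hxdef]
    simp only [mul_assoc]
  have hA : (A : Mat2) * ((A⁻¹ : Matrix.SpecialLinearGroup (Fin 2) ℂ) : Mat2) = 1 := by
    rw [← Matrix.SpecialLinearGroup.coe_mul, mul_inv_cancel, Matrix.SpecialLinearGroup.coe_one]
  have hN0 : N = 0 := by
    rw [← mul_one N, ← hA, ← mul_assoc, hNA, zero_mul]
  rw [hQN, hN0, add_zero]

namespace SurfaceTriangulation

variable {V F D : Type*} {M : SurfaceTriangulation V F D}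

/-! ### Cross ratios under osculating Möbius transformations -/

theorem src_rev (d : D) : M.src (M.rev d) = M.tgt d := rfl

/-- Each factor becomes a difference along a dart of one of the two triangles, the form to which
`sub_eq_of_osculating` applies. -/
theorem crossRatio_eq (z : V → ℂ) (d : D) : M.crossRatio z d =
    -((z (M.src (M.next (M.next d))) - z (M.tgt (M.next (M.next d)))) *
      (z (M.src (M.next (M.next (M.rev d)))) - z (M.tgt (M.next (M.next (M.rev d)))))) /
    ((z (M.src (M.next (M.rev d))) - z (M.tgt (M.next (M.rev d)))) *
      (z (M.src (M.next d)) - z (M.tgt (M.next d)))) := by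
  simp only [tgt_next_next]
  simp only [crossRatio, src_next, tgt_next, tgt_rev, src_rev]

theorem crossRatio_rev (z : V → ℂ) (d : D) : M.crossRatio z (M.rev d) = M.crossRatio z d := by
  rw [crossRatio, crossRatio, M.rev_rev, tgt_rev, tgt]
  congr 1 <;> ring

theorem IsDelaunayPattern.crossRatio_ne_zero {z : V → ℂ} (hz : M.IsDelaunayPattern z) (d : D) :
    M.crossRatio z d ≠ 0 := by
  have h := fun e => sub_ne_zero.2 (hz.edge_ne e)
  rw [crossRatio_eq]
  exact div_ne_zero (neg_ne_zero.2 (mul_ne_zero (h _) (h _))) (mul_ne_zero (h _) (h _))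

theorem sub_eq_of_osculating {z z' : V → ℂ} {A : F → Matrix.SpecialLinearGroup (Fin 2) ℂ}
    {c : D → ℂ}
    (hA : ∀ d, (A (M.face d) : Mat2) *ᵥ ![z (M.src d), 1] = c d • ![z' (M.src d), 1]) (d : D) :
    z (M.src d) - z (M.tgt d) = c d * c (M.next d) * (z' (M.src d) - z' (M.tgt d)) := by
  have h := hA (M.next d)
  rw [face_next, src_next] at h
  exact sub_eq_of_mulVec_lift (A (M.face d)).2 (hA d) h

/-- Each of the four differences contributes two factors `c`; those at the two apices cancel,
leaving only those at the ends of the edge. -/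
theorem crossRatio_of_osculating {z z' : V → ℂ} {A : F → Matrix.SpecialLinearGroup (Fin 2) ℂ}
    {c : D → ℂ} (hc : ∀ d, c d ≠ 0)
    (hA : ∀ d, (A (M.face d) : Mat2) *ᵥ ![z (M.src d), 1] = c d • ![z' (M.src d), 1]) (d : D) :
    M.crossRatio z d =
      M.crossRatio z' d * ((c d * c (M.rev d)) / (c (M.rot d) * c (M.next d))) := by
  have h₁ := hc (M.next (M.next d))
  have h₂ := hc (M.next (M.next (M.rev d)))
  have h₃ := hc (M.rot d)
  have h₄ := hc (M.next d)
  rw [crossRatio_eq, crossRatio_eq, sub_eq_of_osculating hA, sub_eq_of_osculating hA,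
    sub_eq_of_osculating hA, sub_eq_of_osculating hA, M.next_next_next, M.next_next_next,
    show M.next (M.rev d) = M.rot d from rfl, div_mul_div_comm]
  rw [show M.next (M.rev d) = M.rot d from rfl] at h₂
  rw [show c (M.rot d) * c (M.next (M.rot d)) *
      (z' (M.src (M.rot d)) - z' (M.tgt (M.rot d))) *
      (c (M.next d) * c (M.next (M.next d)) * (z' (M.src (M.next d)) - z' (M.tgt (M.next d)))) =
      c (M.next (M.next d)) * c (M.next (M.rot d)) *
      ((z' (M.src (M.rot d)) - z' (M.tgt (M.rot d))) *
      (z' (M.src (M.next d)) - z' (M.tgt (M.next d))) * (c (M.rot d) * c (M.next d))) by ring,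
    ← mul_div_mul_left (-(_ * _) * _) _ (mul_ne_zero h₁ h₂)]
  congr 1
  ring

theorem exists_osculating_of_distinct {z₁ z₂ z₃ w₁ w₂ w₃ : ℂ} (h₁₂ : z₁ ≠ z₂) (h₂₃ : z₂ ≠ z₃)
    (h₃₁ : z₃ ≠ z₁) (k₁₂ : w₁ ≠ w₂) (k₂₃ : w₂ ≠ w₃) (k₃₁ : w₃ ≠ w₁) :
    ∃ A : Matrix.SpecialLinearGroup (Fin 2) ℂ,
      (∃ c : ℂ, c ≠ 0 ∧ (A : Mat2) *ᵥ ![z₁, 1] = c • ![w₁, 1]) ∧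
      (∃ c : ℂ, c ≠ 0 ∧ (A : Mat2) *ᵥ ![z₂, 1] = c • ![w₂, 1]) ∧
      (∃ c : ℂ, c ≠ 0 ∧ (A : Mat2) *ᵥ ![z₃, 1] = c • ![w₃, 1]) := by
  have a := sub_ne_zero.2 h₁₂
  have b := sub_ne_zero.2 h₂₃
  have e := sub_ne_zero.2 h₃₁
  have a' := sub_ne_zero.2 k₁₂
  have b' := sub_ne_zero.2 k₂₃
  have e' := sub_ne_zero.2 k₃₁
  -- the factors `c₁, c₂, c₃` are determined by `c₁ c₂ (w₁ - w₂) = z₁ - z₂` etc.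
  obtain ⟨c₁, hc₁⟩ := IsAlgClosed.exists_pow_nat_eq
    ((z₁ - z₂) * (z₃ - z₁) * (w₂ - w₃) / ((w₁ - w₂) * (w₃ - w₁) * (z₂ - z₃))) two_pos
  have hc0 : c₁ ≠ 0 := by
    rintro rfl
    rw [zero_pow two_ne_zero, eq_comm] at hc₁
    simp [a, b, e, a', b', e'] at hc₁
  obtain ⟨c₂, hc₂⟩ : ∃ c, c = (z₁ - z₂) / ((w₁ - w₂) * c₁) := ⟨_, rfl⟩
  obtain ⟨c₃, hc₃⟩ : ∃ c, c = (z₃ - z₁) / ((w₃ - w₁) * c₁) := ⟨_, rfl⟩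
  have e₁₂ : c₁ * c₂ * (w₁ - w₂) = z₁ - z₂ := by rw [hc₂]; field_simp
  have e₃₁ : c₃ * c₁ * (w₃ - w₁) = z₃ - z₁ := by rw [hc₃]; field_simp
  have e₂₃ : c₂ * c₃ * (w₂ - w₃) = z₂ - z₃ := by
    rw [hc₂, hc₃, show (z₁ - z₂) / ((w₁ - w₂) * c₁) * ((z₃ - z₁) / ((w₃ - w₁) * c₁)) * (w₂ - w₃) =
      (z₁ - z₂) * (z₃ - z₁) * (w₂ - w₃) / ((w₁ - w₂) * (w₃ - w₁)) / c₁ ^ 2 by field_simp, hc₁]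
    field_simp
  have n₂ : c₂ ≠ 0 := by rw [hc₂]; exact div_ne_zero a (mul_ne_zero a' hc0)
  have n₃ : c₃ ≠ 0 := by rw [hc₃]; exact div_ne_zero e (mul_ne_zero e' hc0)
  have hdet : ((c₁ * w₁ - c₂ * w₂) / (z₁ - z₂)) * ((z₁ * c₂ - z₂ * c₁) / (z₁ - z₂)) -
      ((z₁ * (c₂ * w₂) - z₂ * (c₁ * w₁)) / (z₁ - z₂)) * ((c₁ - c₂) / (z₁ - z₂)) = 1 := by
    field_simp
    linear_combination (z₁ - z₂) * e₁₂
  -- The matrix is solved from its values on the first two lifts; the three product relations then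
  -- force the value on the third.
  refine ⟨⟨!![(c₁ * w₁ - c₂ * w₂) / (z₁ - z₂), (z₁ * (c₂ * w₂) - z₂ * (c₁ * w₁)) / (z₁ - z₂);
    (c₁ - c₂) / (z₁ - z₂), (z₁ * c₂ - z₂ * c₁) / (z₁ - z₂)], ?_⟩,
    ⟨c₁, hc0, mulVec_lift_iff.2 ?_⟩, ⟨c₂, n₂, mulVec_lift_iff.2 ?_⟩,
    ⟨c₃, n₃, mulVec_lift_iff.2 ?_⟩⟩
  · rw [Matrix.det_fin_two_of, hdet]
  · constructor <;> simp <;> field_simp <;> ring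
  · constructor <;> simp <;> field_simp <;> ring
  · constructor <;> simp <;> field_simp
    · linear_combination c₁ * w₁ * e₂₃ + c₂ * w₂ * e₃₁ + c₃ * w₃ * e₁₂
    · linear_combination c₁ * e₂₃ + c₂ * e₃₁ + c₃ * e₁₂

theorem exists_isOsculating {z z' : V → ℂ} (hz : ∀ d, z (M.src d) ≠ z (M.tgt d))
    (hz' : ∀ d, z' (M.src d) ≠ z' (M.tgt d)) : ∃ A, M.IsOsculating z z' A := by
  have h : ∀ φ, ∃ a : Matrix.SpecialLinearGroup (Fin 2) ℂ, ∀ d, M.face d = φ → ∃ c : ℂ, c ≠ 0 ∧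
      (a : Mat2) *ᵥ ![z (M.src d), 1] = c • ![z' (M.src d), 1] := by
    intro φ
    obtain ⟨d, rfl⟩ := M.face_surjective φ
    have h₁ := hz d
    have h₂ := hz (M.next d)
    have h₃ := hz (M.next (M.next d))
    have k₁ := hz' d
    have k₂ := hz' (M.next d)
    have k₃ := hz' (M.next (M.next d))
    rw [← src_next] at h₁ h₂ h₃ k₁ k₂ k₃
    rw [M.next_next_next] at h₃ k₃
    obtain ⟨a, ha₁, ha₂, ha₃⟩ := exists_osculating_of_distinct h₁ h₂ h₃ k₁ k₂ k₃
    refine ⟨a, fun e he => ?_⟩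
    rcases (M.face_eq_iff d e).1 he.symm with rfl | rfl | rfl
    exacts [ha₁, ha₂, ha₃]
  choose A hA using h
  exact ⟨A, fun d => hA _ d rfl⟩

/-! ### From circle patterns to discrete CMC-1 surfaces -/

theorem exp_arg_sub_mul {X Y : ℂ} (hXY : ‖X‖ = ‖Y‖) :
    Y * Complex.exp ((X.arg - Y.arg : ℝ) * Complex.I) = X := by
  have hX' := Complex.norm_mul_exp_arg_mul_I X
  have hY' := Complex.norm_mul_exp_arg_mul_I Y
  calc Y * Complex.exp ((X.arg - Y.arg : ℝ) * Complex.I)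
      = ‖Y‖ * Complex.exp (Y.arg * Complex.I) * Complex.exp ((X.arg - Y.arg : ℝ) * Complex.I) := by
        rw [hY']
    _ = ‖Y‖ * Complex.exp (X.arg * Complex.I) := by
        rw [mul_assoc, ← Complex.exp_add]
        congr 2
        push_cast
        ring
    _ = X := by rw [← hXY, hX']

theorem mulVec_eq_of_mul_eq {A B Q : Mat2} {z w c c' : ℂ} (hQ : Q * A = B) (hc : c ≠ 0)
    (hA : A *ᵥ ![z, 1] = c • ![w, 1]) (hB : B *ᵥ ![z, 1] = c' • ![w, 1]) :
    Q *ᵥ ![w, 1] = (c' / c) • ![w, 1] := by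
  have h : c • (Q *ᵥ ![w, 1]) = c' • ![w, 1] := by
    rw [← Matrix.mulVec_smul, ← hA, Matrix.mulVec_mulVec, hQ, hB]
  rw [div_eq_inv_mul, mul_smul, ← h, inv_smul_smul₀ hc]

theorem IsOsculating.exists_factor {z z' : V → ℂ} {A : F → Matrix.SpecialLinearGroup (Fin 2) ℂ}
    (hA : M.IsOsculating z z' A) : ∃ c : D → ℂ, (∀ d, c d ≠ 0) ∧
      ∀ d, (A (M.face d) : Mat2) *ᵥ ![z (M.src d), 1] = c d • ![z' (M.src d), 1] := by
  choose c hc hA using hA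
  exact ⟨c, hc, hA⟩

theorem isDiscreteCMC1_of_isOsculating {z z' : V → ℂ} (hz : M.IsDelaunayPattern z)
    (hz' : M.IsDelaunayPattern z') (hs : M.SameShear z z')
    (hanti : ∀ d, z (M.src d) * conj (z (M.tgt d)) ≠ -1)
    {A : F → Matrix.SpecialLinearGroup (Fin 2) ℂ} (hA : M.IsOsculating z z' A) :
    IsDiscreteCMC1 M (fun φ => (A φ : Mat2) * (A φ : Mat2)ᴴ) z' := by
  obtain ⟨c, hc, hA⟩ := hA.exists_factor
  have hnorm : ∀ d, ‖M.crossRatio z d‖ = ‖M.crossRatio z' d‖ := fun d => by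
    have := hs d
    rw [Complex.log_re, Complex.log_re] at this
    exact Real.log_injOn_pos (norm_pos_iff.2 (hz.crossRatio_ne_zero d))
      (norm_pos_iff.2 (hz'.crossRatio_ne_zero d)) this
  set δ : D → ℝ := fun d => (M.crossRatio z d).arg - (M.crossRatio z' d).arg with hδ
  have hδrev : ∀ d, δ (M.rev d) = δ d := fun d => by simp only [hδ, crossRatio_rev]
  have hδpi : ∀ d, |δ d| < Real.pi := fun d => by
    rw [abs_lt]
    have h1 := hz.arg_nonneg d
    have h2 := hz.arg_lt_pi d
    have h3 := hz'.arg_nonneg d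
    have h4 := hz'.arg_lt_pi d
    constructor <;> simp only [hδ] <;> linarith
  have hratio : ∀ d, (c d * c (M.rev d)) / (c (M.rot d) * c (M.next d)) =
      Complex.exp (δ d * Complex.I) := fun d => by
    have h1 := crossRatio_of_osculating hc hA d
    rw [← exp_arg_sub_mul (hnorm d)] at h1
    exact (mul_left_cancel₀ (hz'.crossRatio_ne_zero d) h1).symm
  -- The same edge difference, computed in the triangles on its two sides.
  have hdet : ∀ d, c d * c (M.next d) = c (M.rot d) * c (M.rev d) := fun d => by
    have h1 := sub_eq_of_osculating hA d
    have h2 := sub_eq_of_osculating hA (M.rev d)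
    rw [tgt_rev, src_rev] at h2
    have h3 := sub_ne_zero.2 (hz'.edge_ne d)
    apply mul_right_cancel₀ h3
    rw [← h1, show M.rot d = M.next (M.rev d) from rfl]
    linear_combination -h2
  have hnc : ∀ d, 0 < ‖c d‖ := fun d => norm_pos_iff.2 (hc d)
  -- Multiplying the norms of `hratio` and `hdet` gives `‖c (rot d)‖² = ‖c d‖²`.
  have hnorms : ∀ d, ‖c (M.rot d)‖ = ‖c d‖ ∧ ‖c (M.rev d)‖ = ‖c (M.next d)‖ := fun d => by
    have h1 : ‖c d‖ * ‖c (M.rev d)‖ = ‖c (M.rot d)‖ * ‖c (M.next d)‖ := by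
      have := congr_arg norm (hratio d)
      rw [Complex.norm_exp_ofReal_mul_I, norm_div, norm_mul, norm_mul, div_eq_one_iff_eq] at this
      · exact this
      · exact (mul_pos (hnc _) (hnc _)).ne'
    have h2 : ‖c d‖ * ‖c (M.next d)‖ = ‖c (M.rot d)‖ * ‖c (M.rev d)‖ := by
      rw [← norm_mul, hdet, norm_mul]
    have h3 : ‖c (M.rot d)‖ = ‖c d‖ := by
      rw [← abs_of_pos (hnc (M.rot d)), ← abs_of_pos (hnc d), ← sq_eq_sq_iff_abs_eq_abs]
      apply mul_right_cancel₀ (mul_pos (hnc (M.rev d)) (hnc (M.next d))).ne'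
      linear_combination (-‖c (M.rot d)‖ * ‖c (M.rev d)‖) * h1 - ‖c d‖ * ‖c (M.rev d)‖ * h2
    refine ⟨h3, ?_⟩
    rw [h3] at h1
    exact mul_left_cancel₀ (hnc d).ne' h1
  -- Solved from `normSq_mul_mink_horoVec` with pairing `-1`. The chosen dart is immaterial, as
  -- `‖c‖` is constant around a vertex.
  set size : V → ℝ := fun v => ‖c (Function.surjInv M.src_surjective v)‖ ^ 2 *
    (1 + ‖z' v‖ ^ 2) / (1 + ‖z v‖ ^ 2) with hsize
  have hsize_pos : ∀ v, 0 < size v := fun v => by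
    have := hnc (Function.surjInv M.src_surjective v)
    simp only [hsize]
    positivity
  have hsize_src : ∀ d, horoScale (z' (M.src d)) (size (M.src d)) * (1 + ‖z (M.src d)‖ ^ 2) =
      2 * ‖c d‖ ^ 2 := fun d => by
    have h := M.eq_of_src_eq (g := fun e => ‖c e‖) (fun e => (hnorms e).1)
      (Function.surjInv_eq M.src_surjective (M.src d))
    simp only [hsize, horoScale, ← h]
    field_simp
  have hmem : ∀ d, (A (M.face d) : Mat2) * (A (M.face d) : Mat2)ᴴ ∈
      horosphere (horoVec (z' (M.src d)) (size (M.src d))) := fun d => by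
    refine ⟨mul_conjTranspose_mem_hyperbolicSpace (A (M.face d)).2, ?_⟩
    have h1 := normSq_mul_mink_horoVec (A (M.face d)).2 (hA d) (size (M.src d))
    have h2 := hsize_src d
    rw [Complex.normSq_eq_norm_sq, Complex.normSq_eq_norm_sq, h2] at h1
    apply mul_left_cancel₀ (pow_pos (hnc d) 2).ne'
    rw [h1]
    ring
  have hmem' : ∀ d, (A (M.face d) : Mat2) * (A (M.face d) : Mat2)ᴴ ∈
      horosphere (horoVec (z' (M.tgt d)) (size (M.tgt d))) := fun d => by
    have := hmem (M.next d)
    rwa [face_next, src_next] at this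
  have htan : ∀ d, -2 < mink (horoVec (z' (M.src d)) (size (M.src d)))
      (horoVec (z' (M.tgt d)) (size (M.tgt d))) := fun d => by
    have h := hA (M.next d)
    rw [face_next, src_next] at h
    exact (neg_two_lt_mink_horoVec_iff (A (M.face d)).2 (hA d) h (hsize_pos _) (hsize_pos _)
      (hmem d).2 (hmem' d).2).2 (hanti d)
  set α : D → ℝ := fun d => (if 0 ≤ δ d then 1 else -1) *
    Real.arccos (1 + mink (horoVec (z' (M.src d)) (size (M.src d)))
      (horoVec (z' (M.tgt d)) (size (M.tgt d)))) with hα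
  have harc : ∀ d, ∃ T, IsShortArc (horoVec (z' (M.src d)) (size (M.src d)))
        (horoVec (z' (M.tgt d)) (size (M.tgt d)))
        ((A (M.face d) : Mat2) * (A (M.face d) : Mat2)ᴴ)
        ((A (M.face (M.rev d)) : Mat2) * (A (M.face (M.rev d)) : Mat2)ᴴ) T |δ d| ∧
      α d ∈ Set.Ioo (-Real.pi) Real.pi ∧ _ ∧ _ ∧ _ := fun d => by
    set Q : Mat2 := (A (M.face (M.rev d)) : Mat2) *
      (((A (M.face d))⁻¹ : Matrix.SpecialLinearGroup (Fin 2) ℂ) : Mat2) with hQ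
    have hQA : Q * (A (M.face d) : Mat2) = A (M.face (M.rev d)) := by
      rw [hQ, mul_assoc, ← Matrix.SpecialLinearGroup.coe_mul, inv_mul_cancel,
        Matrix.SpecialLinearGroup.coe_one, mul_one]
    have hQx : hermCong Q ((A (M.face d) : Mat2) * (A (M.face d) : Mat2)ᴴ) =
        (A (M.face (M.rev d)) : Mat2) * (A (M.face (M.rev d)) : Mat2)ᴴ := by
      rw [← hermCong_one_right, hermCong_hermCong, hQA, hermCong_one_right]
    have k1 := hA (M.rot d)
    rw [face_rot, src_rot] at k1
    have k2 := hA (M.next d)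
    rw [face_next, src_next] at k2
    have k3 := hA (M.rev d)
    rw [src_rev] at k3
    have hl : ‖c (M.rot d) / c d‖ = 1 := by
      rw [norm_div, (hnorms d).1, div_self (hnc d).ne']
    have hmu : ‖c (M.rev d) / c (M.next d)‖ = 1 := by
      rw [norm_div, (hnorms d).2, div_self (hnc _).ne']
    -- For a unimodular number conjugation is inversion, so this is the inverse of the factor in
    -- `hratio d`.
    have hlm : c (M.rot d) / c d * conj (c (M.rev d) / c (M.next d)) =
        Complex.exp (-δ d * Complex.I) := by
      rw [← Complex.inv_eq_conj hmu, neg_mul, Complex.exp_neg, ← hratio]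
      have e1 := hc d
      have e2 := hc (M.rot d)
      have e3 := hc (M.rev d)
      have e4 := hc (M.next d)
      field_simp
    have := exists_arc_of_rotation (hsize_pos (M.src d)) (hsize_pos (M.tgt d)) (hz'.edge_ne d)
      (hmem d) (hmem' d) (htan d) (mulVec_eq_of_mul_eq hQA (hc d) (hA d) k1)
      (mulVec_eq_of_mul_eq hQA (hc _) k2 k3) hl hmu (hδpi d) hlm (α := α d) rfl
    rwa [hQx] at this
  choose T hT hαmem hcos hsin htanδ using harc
  have hαrev : ∀ d, α (M.rev d) = α d := fun d => by
    simp only [hα, hδrev, tgt_rev, src_rev]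
    rw [mink_comm (isHermitian_horoVec _ _) (isHermitian_horoVec _ _)]
  refine ⟨⟨fun φ => (A φ : Mat2) * (A φ : Mat2)ᴴ, z', size, T, fun d => |δ d|, α, hsize_pos, hmem,
    hz', hT, hαmem, hαrev, hcos, hsin⟩, rfl, rfl, ?_⟩
  refine ⟨fun v => ?_, fun d => ?_, fun d => ?_⟩
  · rw [HorosphericalNet.integratedMeanCurvature, add_eq_left]
    have : ∑ d ∈ M.star v, δ d = 0 := by
      simp only [hδ, Finset.sum_sub_distrib, hz.no_branching, hz'.no_branching, sub_self]
    rw [← mul_zero (1 / 2 : ℝ), ← this]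
    congr 1
    exact Finset.sum_congr rfl fun d _ => htanδ d
  · refine (hz.arg_nonneg d).trans_eq ?_
    rw [← sub_eq_iff_eq_add]
    exact (htanδ d).symm
  · refine lt_of_eq_of_lt ?_ (hz.arg_lt_pi d)
    rw [← eq_sub_iff_add_eq]
    exact htanδ d

end SurfaceTriangulation

/-! ### From discrete CMC-1 surfaces to circle patterns -/

theorem abs_lt_pi_of_mem_Ico {δ θ : ℝ} (h₁ : 0 ≤ δ + θ) (h₂ : δ + θ < Real.pi) (h₃ : 0 ≤ θ)
    (h₄ : θ < Real.pi) : |δ| < Real.pi :=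
  abs_lt.2 ⟨by linarith, by linarith⟩

theorem arg_mul_exp_eq {Y : ℂ} (hY : Y ≠ 0) {δ : ℝ} (h₁ : 0 ≤ δ + Y.arg)
    (h₂ : δ + Y.arg < Real.pi) : (Y * Complex.exp (δ * Complex.I)).arg = δ + Y.arg := by
  have : Y * Complex.exp (δ * Complex.I) =
      ‖Y‖ * (Complex.cos (δ + Y.arg : ℝ) + Complex.sin (δ + Y.arg : ℝ) * Complex.I) := by
    rw [← Complex.exp_mul_I]
    conv_lhs => rw [← Complex.norm_mul_exp_arg_mul_I Y]
    rw [mul_assoc, ← Complex.exp_add]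
    congr 2
    push_cast
    ring
  rw [this, Complex.arg_mul_cos_add_sin_mul_I (norm_pos_iff.2 hY)
    ⟨by linarith [Real.pi_pos], h₂.le⟩]

/-- A countable family of directions in `ℂ²` can be moved away from the first coordinate axis by a
single unitary transformation. -/
theorem exists_unitary_ne_zero {ι : Type*} [Countable ι] {u : ι → Fin 2 → ℂ} (hu : ∀ i, u i ≠ 0) :
    ∃ U : Matrix.SpecialLinearGroup (Fin 2) ℂ, (U : Mat2) * (U : Mat2)ᴴ = 1 ∧
      ∀ i, (((U⁻¹ : Matrix.SpecialLinearGroup (Fin 2) ℂ) : Mat2) *ᵥ u i) 1 ≠ 0 := by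
  -- A real rotation of slope `t` suffices: each direction excludes at most one `t`, and the reals
  -- are uncountable.
  have hcount : (⋃ i, {t : ℝ | u i 1 = t * u i 0}).Countable := by
    refine Set.countable_iUnion fun i => Set.Subsingleton.countable ?_
    intro s hs t ht
    simp only [Set.mem_ofPred_eq] at hs ht
    by_cases h0 : u i 0 = 0
    · rw [h0, mul_zero] at hs
      exact absurd (by ext j; fin_cases j; exacts [h0, hs]) (hu i)
    · exact_mod_cast mul_right_cancel₀ h0 (hs.symm.trans ht)
  obtain ⟨t, ht⟩ : ∃ t : ℝ, t ∉ ⋃ i, {t : ℝ | u i 1 = t * u i 0} := by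
    by_contra! h
    exact Set.not_countable_univ_iff.2 inferInstance
      (hcount.mono fun t _ => h t)
  have hs : 0 < Real.sqrt (1 + t ^ 2) := Real.sqrt_pos.2 (by positivity)
  have hsC : (Real.sqrt (1 + t ^ 2) : ℂ) ≠ 0 := by exact_mod_cast hs.ne'
  have hs2 : (Real.sqrt (1 + t ^ 2) : ℂ) ^ 2 = 1 + (t : ℂ) ^ 2 := by
    exact_mod_cast Real.sq_sqrt (by positivity : (0 : ℝ) ≤ 1 + t ^ 2)
  have hd : (!![(Real.sqrt (1 + t ^ 2) : ℂ)⁻¹, -t * (Real.sqrt (1 + t ^ 2) : ℂ)⁻¹;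
      t * (Real.sqrt (1 + t ^ 2) : ℂ)⁻¹, (Real.sqrt (1 + t ^ 2) : ℂ)⁻¹] : Mat2).det = 1 := by
    rw [Matrix.det_fin_two_of]
    field_simp
    rw [hs2]; ring
  obtain ⟨U, hU⟩ : ∃ U : Matrix.SpecialLinearGroup (Fin 2) ℂ, (U : Mat2) =
      !![(Real.sqrt (1 + t ^ 2) : ℂ)⁻¹, -t * (Real.sqrt (1 + t ^ 2) : ℂ)⁻¹;
        t * (Real.sqrt (1 + t ^ 2) : ℂ)⁻¹, (Real.sqrt (1 + t ^ 2) : ℂ)⁻¹] := ⟨⟨_, hd⟩, rfl⟩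
  refine ⟨U, ?_, fun i h => ht (Set.mem_iUnion.2 ⟨i, ?_⟩)⟩
  · rw [hU]
    ext i j
    fin_cases i <;> fin_cases j <;> simp [Matrix.mul_apply, Fin.sum_univ_two] <;> field_simp <;>
      first | ring1 | linear_combination -hs2
  · rw [Matrix.SpecialLinearGroup.coe_inv, hU] at h
    simp [Matrix.adjugate_fin_two, Matrix.mulVec, dotProduct, Fin.sum_univ_two] at h
    have h' : (Real.sqrt (1 + t ^ 2) : ℂ)⁻¹ * (u i 1 - t * u i 0) = 0 := by
      rw [← h]; ring
    exact sub_eq_zero.1 ((mul_eq_zero.1 h').resolve_left (inv_ne_zero hsC))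

/-! ### Integrating the edge rotations of a discrete CMC-1 surface -/

namespace HorosphericalNet

variable {V F D : Type*} {M : SurfaceTriangulation V F D} (n : HorosphericalNet M)

/-- The rotation angle of the elliptic Möbius transformation along an edge. -/
noncomputable def angle (d : D) : ℝ := n.length d * Real.tan (n.α d / 2)

theorem mem_horosphere_tgt (d : D) :
    n.f (M.face d) ∈ horosphere (horoVec (n.gauss (M.tgt d)) (n.size (M.tgt d))) := by
  have := n.mem_horosphere (M.next d)
  rwa [M.face_next, M.src_next] at this

theorem neg_two_lt_mink (d : D) : -2 < mink (horoVec (n.gauss (M.src d)) (n.size (M.src d)))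
    (horoVec (n.gauss (M.tgt d)) (n.size (M.tgt d))) :=
  ((n.arc d).hermCong_eq (n.size_pos _) (n.size_pos _) (n.delaunay.edge_ne d) (n.mem_horosphere d)
    (n.mem_horosphere_tgt d) (n.α_mem d) (n.cos_α d) (n.sin_α d)).1

/-- `Q` is the elliptic Möbius transformation along the edge `d`. -/
def IsEdgeRotation (d : D) (Q : Matrix.SpecialLinearGroup (Fin 2) ℂ) : Prop :=
  (Q : Mat2) *ᵥ ![n.gauss (M.src d), 1] =
      Complex.exp ((-(n.angle d / 2) : ℝ) * Complex.I) • ![n.gauss (M.src d), 1] ∧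
    (Q : Mat2) *ᵥ ![n.gauss (M.tgt d), 1] =
      Complex.exp ((n.angle d / 2 : ℝ) * Complex.I) • ![n.gauss (M.tgt d), 1]

theorem exists_isEdgeRotation (d : D) : ∃ Q, n.IsEdgeRotation d Q := by
  obtain ⟨Q, h₁, h₂⟩ := exists_specialLinear_eigen (n.delaunay.edge_ne d)
    (Complex.exp_ne_zero ((-(n.angle d / 2) : ℝ) * Complex.I))
  refine ⟨Q, h₁, ?_⟩
  rw [h₂, ← Complex.exp_neg]
  congr 2
  push_cast
  ring

variable {n}

theorem IsEdgeRotation.hermCong_eq {d : D} {Q : Matrix.SpecialLinearGroup (Fin 2) ℂ}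
    (hQ : n.IsEdgeRotation d Q) : hermCong Q (n.f (M.face d)) = n.f (M.face (M.rev d)) := by
  refine ((n.arc d).hermCong_eq (n.size_pos _) (n.size_pos _) (n.delaunay.edge_ne d)
    (n.mem_horosphere d) (n.mem_horosphere_tgt d) (n.α_mem d) (n.cos_α d) (n.sin_α d)).2 _ _ _
    hQ.1 hQ.2 (Complex.norm_exp_ofReal_mul_I _) (Complex.norm_exp_ofReal_mul_I _) ?_
  rw [← Complex.inv_eq_conj (Complex.norm_exp_ofReal_mul_I _), ← Complex.exp_neg,
    ← Complex.exp_add]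
  congr 1
  have : n.τ d * circRadius (horoVec (n.gauss (M.src d)) (n.size (M.src d)))
      (horoVec (n.gauss (M.tgt d)) (n.size (M.tgt d))) (n.f (M.face d)) *
      Real.tan (n.α d / 2) = n.angle d := rfl
  rw [this]
  push_cast
  ring

theorem IsCMC1.abs_angle_lt_pi (hn : n.IsCMC1) (d : D) : |n.angle d| < Real.pi :=
  abs_lt_pi_of_mem_Ico (hn.edge_nonneg d) (hn.edge_lt_pi d) (n.delaunay.arg_nonneg d)
    (n.delaunay.arg_lt_pi d)

/-- The arcs of `d` and `rev d` are separate data. Going forth and back fixes a point off the axis,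
so the angles agree modulo `2π`; both lie in `(-π, π)`. -/
theorem IsCMC1.angle_rev (hn : n.IsCMC1) (d : D) : n.angle (M.rev d) = n.angle d := by
  obtain ⟨Q, hQ⟩ := n.exists_isEdgeRotation d
  obtain ⟨Q', hQ'⟩ := n.exists_isEdgeRotation (M.rev d)
  have hx : hermCong ((Q' : Mat2) * (Q : Mat2)) (n.f (M.face d)) = n.f (M.face d) := by
    rw [← hermCong_hermCong, hQ.hermCong_eq, hQ'.hermCong_eq, M.rev_rev]
  obtain ⟨h₁, h₂⟩ := hQ
  obtain ⟨h₁', h₂'⟩ := hQ'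
  rw [M.src_rev] at h₁'
  rw [M.tgt_rev] at h₂'
  have e₁ : ((Q' : Mat2) * (Q : Mat2)) *ᵥ ![n.gauss (M.src d), 1] =
      Complex.exp (((n.angle (M.rev d) - n.angle d) / 2 : ℝ) * Complex.I) •
        ![n.gauss (M.src d), 1] := by
    rw [← Matrix.mulVec_mulVec, h₁, Matrix.mulVec_smul, h₂', smul_smul, ← Complex.exp_add]
    congr 2
    push_cast
    ring
  have e₂ : ((Q' : Mat2) * (Q : Mat2)) *ᵥ ![n.gauss (M.tgt d), 1] =
      Complex.exp ((-((n.angle (M.rev d) - n.angle d) / 2) : ℝ) * Complex.I) •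
        ![n.gauss (M.tgt d), 1] := by
    rw [← Matrix.mulVec_mulVec, h₂, Matrix.mulVec_smul, h₁', smul_smul, ← Complex.exp_add]
    congr 2
    push_cast
    ring
  have h := eigen_ratio_eq_one (n.size_pos _) (n.size_pos _) (n.delaunay.edge_ne d)
    (n.mem_horosphere d) (n.mem_horosphere_tgt d) (n.neg_two_lt_mink d) e₁ e₂
    (Complex.norm_exp_ofReal_mul_I _) (Complex.norm_exp_ofReal_mul_I _) hx
  rw [← Complex.inv_eq_conj (Complex.norm_exp_ofReal_mul_I _), ← Complex.exp_neg,
    ← Complex.exp_add] at h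
  obtain ⟨k, hk⟩ := Complex.exp_eq_one_iff.1 h
  have hk' : n.angle (M.rev d) - n.angle d = k * (2 * Real.pi) := by
    have := congr_arg Complex.im hk
    simp at this
    linarith
  have b₁ := abs_lt.1 (hn.abs_angle_lt_pi d)
  have b₂ := abs_lt.1 (hn.abs_angle_lt_pi (M.rev d))
  have hk0 : k = 0 := by
    have l₁ : (k : ℝ) < 1 := by nlinarith [Real.pi_pos]
    have l₂ : (-1 : ℝ) < k := by nlinarith [Real.pi_pos]
    have l₁' : k < 1 := by exact_mod_cast l₁
    have l₂' : -1 < k := by exact_mod_cast l₂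
    omega
  rw [hk0] at hk'
  simp at hk'
  linarith

theorem IsCMC1.sum_angle (hn : n.IsCMC1) (v : V) : ∑ d ∈ M.star v, n.angle d = 0 := by
  have h := hn.mean_curvature v
  rw [integratedMeanCurvature, add_eq_left] at h
  exact (mul_eq_zero.1 h).resolve_left (by norm_num)

open SurfaceTriangulation

/-- The edge rotations integrate to a map of the dual vertices. -/
theorem IsCMC1.exists_frame (hn : n.IsCMC1) (hM : M.IsSimplyConnected) (φ₀ : F) :
    ∃ A : F → Matrix.SpecialLinearGroup (Fin 2) ℂ,
      (∀ φ, n.f φ = (A φ : Mat2) * (A φ : Mat2)ᴴ) ∧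
      ∃ R : D → Matrix.SpecialLinearGroup (Fin 2) ℂ, (∀ d, n.IsEdgeRotation d (R d)) ∧
        ∀ d, A (M.face (M.rev d)) = R d * A (M.face d) := by
  choose R hR using n.exists_isEdgeRotation
  have hrev : ∀ d, R (M.rev d) * R d = 1 := fun d => by
    obtain ⟨h₁, h₂⟩ := hR d
    obtain ⟨h₁', h₂'⟩ := hR (M.rev d)
    rw [M.src_rev, hn.angle_rev] at h₁'
    rw [M.tgt_rev, hn.angle_rev] at h₂'
    apply Subtype.ext
    rw [Matrix.SpecialLinearGroup.coe_mul, Matrix.SpecialLinearGroup.coe_one]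
    apply eq_of_mulVec_lift_eq (n.delaunay.edge_ne d)
    · rw [← Matrix.mulVec_mulVec, h₁, Matrix.mulVec_smul, h₂', smul_smul, ← Complex.exp_add]
      simp
    · rw [← Matrix.mulVec_mulVec, h₂, Matrix.mulVec_smul, h₁', smul_smul, ← Complex.exp_add]
      simp
  -- Walking around a vertex, the partial products keep its lift as an eigenvector and carry `f`
  -- along.
  have hpath : ∀ d k,
      ((holonomy R ((List.range k).map fun j => M.rot^[j] d) : _) : Mat2) *ᵥ
        ![n.gauss (M.src d), 1] = Complex.exp ((-((∑ j ∈ Finset.range k, n.angle (M.rot^[j] d)) / 2)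
          : ℝ) * Complex.I) • ![n.gauss (M.src d), 1] ∧
      hermCong (holonomy R ((List.range k).map fun j => M.rot^[j] d) : _) (n.f (M.face d)) =
        n.f (M.face (M.rot^[k] d)) := by
    intro d k
    induction k with
    | zero => simp [holonomy, hermCong]
    | succ k ih =>
      have hk := hR (M.rot^[k] d)
      rw [List.range_succ, List.map_append, List.map_singleton, holonomy_append]
      simp only [holonomy, one_mul]
      rw [Matrix.SpecialLinearGroup.coe_mul, ← hermCong_hermCong, ih.2, hk.hermCong_eq,
        ← Matrix.mulVec_mulVec, ih.1, Matrix.mulVec_smul, Function.iterate_succ_apply', M.face_rot]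
      refine ⟨?_, rfl⟩
      have h₁ := hk.1
      rw [M.src_rot_iterate] at h₁
      rw [h₁, smul_smul, ← Complex.exp_add, Finset.sum_range_succ]
      congr 2
      push_cast
      ring
  -- As the angles sum to exactly zero, the half angles give eigenvalue `1` and not `-1`: the loop
  -- is trivial in `SL(2, ℂ)`, not merely up to sign.
  have hloop : ∀ d k, M.rot^[k] d = d →
      holonomy R ((List.range k).map fun j => M.rot^[j] d) = 1 := fun d k hk => by
    obtain ⟨h₁, h₂⟩ := hpath d k
    rw [M.sum_range_rot_eq_zero (hn.sum_angle _) hk] at h₁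
    rw [hk] at h₂
    apply Subtype.ext
    exact eq_one_of_hermCong_eq (holonomy R _).2 (by simpa using h₁) (n.mem_horosphere d).1 h₂
  obtain ⟨d₀, hd₀⟩ := M.face_surjective φ₀
  obtain ⟨a, ha⟩ := exists_mul_conjTranspose_eq (n.mem_horosphere d₀).1
  rw [hd₀] at ha
  obtain ⟨A, hA₀, hA⟩ := hM.exists_primitive hrev hloop φ₀ a
  refine ⟨A, hM.face_induction (φ₀ := φ₀) (by rw [hA₀, ha]) fun d hd => ?_, R, hR, hA⟩
  rw [hA, ← (hR d).hermCong_eq, hd, ← hermCong_one_right, hermCong_hermCong, hermCong_one_right,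
    Matrix.SpecialLinearGroup.coe_mul]

/-- The osculating Möbius transformation can be chosen such that no vertex of the resulting circle
pattern lies at infinity. -/
theorem IsCMC1.exists_osculating (hn : n.IsCMC1) (hM : M.IsSimplyConnected) :
    ∃ (z : V → ℂ) (A : F → Matrix.SpecialLinearGroup (Fin 2) ℂ) (c : D → ℂ),
      (∀ φ, n.f φ = (A φ : Mat2) * (A φ : Mat2)ᴴ) ∧ (∀ d, c d ≠ 0) ∧
      (∀ d, (A (M.face d) : Mat2) *ᵥ ![z (M.src d), 1] = c d • ![n.gauss (M.src d), 1]) ∧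
      ∀ d, (c d * c (M.rev d)) / (c (M.rot d) * c (M.next d)) =
        Complex.exp (n.angle d * Complex.I) := by
  rcases isEmpty_or_nonempty F with hF | ⟨⟨φ₀⟩⟩
  · exact ⟨fun _ => 0, fun φ => hF.elim φ, fun _ => 1, fun φ => hF.elim φ,
      fun d => hF.elim (M.face d), fun d => hF.elim (M.face d), fun d => hF.elim (M.face d)⟩
  obtain ⟨B, hB, R, hR, hBR⟩ := hn.exists_frame hM φ₀
  have := hM.countable_darts
  have hcancel : ∀ (a : Matrix.SpecialLinearGroup (Fin 2) ℂ) (u : Fin 2 → ℂ),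
      (a : Mat2) *ᵥ (((a⁻¹ : Matrix.SpecialLinearGroup (Fin 2) ℂ) : Mat2) *ᵥ u) = u := by
    intro a u
    rw [Matrix.mulVec_mulVec, ← Matrix.SpecialLinearGroup.coe_mul, mul_inv_cancel,
      Matrix.SpecialLinearGroup.coe_one, Matrix.one_mulVec]
  obtain ⟨U, hU, hU1⟩ := exists_unitary_ne_zero (u := fun d =>
    (((B (M.face d))⁻¹ : Matrix.SpecialLinearGroup (Fin 2) ℂ) : Mat2) *ᵥ ![n.gauss (M.src d), 1])
    (fun d h => by
      have := hcancel (B (M.face d)) ![n.gauss (M.src d), 1]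
      rw [h, Matrix.mulVec_zero] at this
      simpa using congr_fun this 1)
  set A : F → Matrix.SpecialLinearGroup (Fin 2) ℂ := fun φ => B φ * U with hA
  have hAR : ∀ d, A (M.face (M.rev d)) = R d * A (M.face d) := fun d => by
    simp only [hA, hBR, mul_assoc]
  have hAf : ∀ φ, n.f φ = (A φ : Mat2) * (A φ : Mat2)ᴴ := fun φ => by
    simp only [hA]
    rw [hB, Matrix.SpecialLinearGroup.coe_mul, Matrix.conjTranspose_mul, mul_assoc,
      ← mul_assoc (U : Mat2), hU, one_mul]
  -- Lifts of the sought `z` to `ℂ²`, one for each corner of a triangle. By `hgrot` they change only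
  -- by a phase around a vertex, so their quotients depend on the vertex alone.
  set g : D → Fin 2 → ℂ := fun d =>
    (((A (M.face d))⁻¹ : Matrix.SpecialLinearGroup (Fin 2) ℂ) : Mat2) *ᵥ ![n.gauss (M.src d), 1]
    with hg
  have hg1 : ∀ d, g d 1 ≠ 0 := fun d => by
    have h := hU1 d
    rw [Matrix.mulVec_mulVec, ← Matrix.SpecialLinearGroup.coe_mul, ← mul_inv_rev] at h
    exact h
  have hAg : ∀ d, (A (M.face d) : Mat2) *ᵥ g d = ![n.gauss (M.src d), 1] := fun d => hcancel _ _
  have hinj : ∀ (a : Matrix.SpecialLinearGroup (Fin 2) ℂ) {u u' : Fin 2 → ℂ},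
      (a : Mat2) *ᵥ u = (a : Mat2) *ᵥ u' → u = u' := fun a u u' h => by
    rw [← hcancel a⁻¹ u, ← hcancel a⁻¹ u', inv_inv, h]
  have hgrot : ∀ d, g d = Complex.exp ((-(n.angle d / 2) : ℝ) * Complex.I) • g (M.rot d) := by
    intro d
    apply hinj (A (M.face (M.rev d)))
    have h := hAg (M.rot d)
    rw [M.face_rot, M.src_rot] at h
    rw [Matrix.mulVec_smul, h, hAR, Matrix.SpecialLinearGroup.coe_mul, ← Matrix.mulVec_mulVec,
      hAg, (hR d).1]
  have hgrev : ∀ d, g (M.next d) = Complex.exp ((n.angle d / 2 : ℝ) * Complex.I) • g (M.rev d) := by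
    intro d
    apply hinj (A (M.face (M.rev d)))
    have h := hAg (M.next d)
    rw [M.face_next, M.src_next] at h
    have h' := hAg (M.rev d)
    rw [M.src_rev] at h'
    rw [Matrix.mulVec_smul, h', hAR, Matrix.SpecialLinearGroup.coe_mul, ← Matrix.mulVec_mulVec,
      h, (hR d).2]
  have hz : ∀ d, g (Function.surjInv M.src_surjective (M.src d)) 0 /
      g (Function.surjInv M.src_surjective (M.src d)) 1 = g d 0 / g d 1 := fun d => by
    refine (M.eq_of_src_eq (g := fun e => g e 0 / g e 1) (fun e => ?_)
      (Function.surjInv_eq M.src_surjective (M.src d))).symm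
    rw [hgrot e, Pi.smul_apply, Pi.smul_apply, smul_eq_mul, smul_eq_mul,
      mul_div_mul_left _ _ (Complex.exp_ne_zero _)]
  refine ⟨fun v => g (Function.surjInv M.src_surjective v) 0 /
    g (Function.surjInv M.src_surjective v) 1, A, fun d => (g d 1)⁻¹, hAf,
    fun d => inv_ne_zero (hg1 d), fun d => ?_, fun d => ?_⟩
  · have : ![g d 0 / g d 1, 1] = (g d 1)⁻¹ • g d := by
      have h := hg1 d
      ext i
      fin_cases i
      · simp [div_eq_inv_mul]
      · simp [h]
    beta_reduce
    rw [hz, this, Matrix.mulVec_smul, hAg]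
  · have e₁ := congr_fun (hgrot d) 1
    have e₂ := congr_fun (hgrev d) 1
    rw [Pi.smul_apply, smul_eq_mul] at e₁ e₂
    have h₁ := hg1 (M.rot d)
    have h₂ := hg1 (M.rev d)
    have h₃ := Complex.exp_ne_zero ((-(n.angle d / 2) : ℝ) * Complex.I)
    beta_reduce
    rw [e₁, e₂, show Complex.exp (n.angle d * Complex.I) =
      Complex.exp ((n.angle d / 2 : ℝ) * Complex.I) /
        Complex.exp ((-(n.angle d / 2) : ℝ) * Complex.I) by
        rw [← Complex.exp_sub]; congr 1; push_cast; ring]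
    field_simp

/-- The cross ratios are multiplied by `exp (angle * I)`. The bounds in `IsCMC1` keep the new
argument in the principal range, so arguments add without a jump by `2π` and the angle sums carry
over. -/
theorem IsCMC1.exists_circlePattern (hn : n.IsCMC1) (hM : M.IsSimplyConnected) :
    ∃ (z : V → ℂ) (A : F → Matrix.SpecialLinearGroup (Fin 2) ℂ),
      M.IsDelaunayPattern z ∧ M.IsOsculating z n.gauss A ∧
      (∀ φ, n.f φ = (A φ : Mat2) * (A φ : Mat2)ᴴ) ∧ M.SameShear z n.gauss ∧
      ∀ d, z (M.src d) * conj (z (M.tgt d)) ≠ -1 := by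
  obtain ⟨z, A, c, hf, hc, hA, hratio⟩ := hn.exists_osculating hM
  have hX : ∀ d, M.crossRatio z d =
      M.crossRatio n.gauss d * Complex.exp (n.angle d * Complex.I) := fun d => by
    rw [crossRatio_of_osculating hc hA, hratio]
  have harg : ∀ d, (M.crossRatio z d).arg = n.angle d + (M.crossRatio n.gauss d).arg := fun d => by
    rw [hX]
    exact arg_mul_exp_eq (n.delaunay.crossRatio_ne_zero d) (hn.edge_nonneg d) (hn.edge_lt_pi d)
  refine ⟨z, A, ⟨fun d => ?_, fun v => ?_, fun d => ?_, fun d => ?_⟩,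
    fun d => ⟨c d, hc d, hA d⟩, hf, fun d => ?_, fun d => ?_⟩
  · rw [← sub_ne_zero, sub_eq_of_osculating hA]
    exact mul_ne_zero (mul_ne_zero (hc _) (hc _)) (sub_ne_zero.2 (n.delaunay.edge_ne d))
  · simp only [harg, Finset.sum_add_distrib]
    rw [hn.sum_angle, n.delaunay.no_branching, zero_add]
  · rw [harg]
    exact hn.edge_nonneg d
  · rw [harg]
    exact hn.edge_lt_pi d
  · rw [Complex.log_re, Complex.log_re, hX, norm_mul, Complex.norm_exp_ofReal_mul_I, mul_one]
  · have h := hA (M.next d)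
    rw [M.face_next, M.src_next] at h
    have h₁ := (n.mem_horosphere d).2
    have h₂ := (n.mem_horosphere_tgt d).2
    rw [hf] at h₁ h₂
    exact (neg_two_lt_mink_horoVec_iff (A (M.face d)).2 (hA d) h (n.size_pos _) (n.size_pos _)
      h₁ h₂).1 (n.neg_two_lt_mink d)

end HorosphericalNet

theorem theorem4p3 {V F D : Type*} (M : SurfaceTriangulation V F D) (hM : M.IsSimplyConnected) :
    (∀ z z' : V → ℂ, M.IsDelaunayPattern z → M.IsDelaunayPattern z' → M.SameShear z z' →
      (∀ d, z (M.src d) * (starRingEnd ℂ) (z (M.tgt d)) ≠ -1) →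
      (∃ A, M.IsOsculating z z' A) ∧
      ∀ A : F → Matrix.SpecialLinearGroup (Fin 2) ℂ, M.IsOsculating z z' A →
        IsDiscreteCMC1 M
          (fun φ => (A φ : Matrix (Fin 2) (Fin 2) ℂ) * (A φ : Matrix (Fin 2) (Fin 2) ℂ)ᴴ) z') ∧
    (∀ (f : F → Matrix (Fin 2) (Fin 2) ℂ) (z' : V → ℂ), IsDiscreteCMC1 M f z' →
      ∃ (z : V → ℂ) (A : F → Matrix.SpecialLinearGroup (Fin 2) ℂ),
        M.IsDelaunayPattern z ∧ M.IsOsculating z z' A ∧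
        (∀ φ, f φ = (A φ : Matrix (Fin 2) (Fin 2) ℂ) * (A φ : Matrix (Fin 2) (Fin 2) ℂ)ᴴ) ∧
        M.SameShear z z' ∧
        ∀ d, z (M.src d) * (starRingEnd ℂ) (z (M.tgt d)) ≠ -1) := by
  constructor
  · intro z z' hz hz' hs hanti
    exact ⟨SurfaceTriangulation.exists_isOsculating hz.edge_ne hz'.edge_ne, fun A hA =>
      SurfaceTriangulation.isDiscreteCMC1_of_isOsculating hz hz' hs hanti hA⟩
  · rintro f z' ⟨n, rfl, rfl, hn⟩
    exact hn.exists_circlePattern hM
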